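/- **Theorem (noiseless test loss).** Let $d,n\ge 1$ and $1\ge p_1\ge\dots\ge p_d>0$. Let $\mathcal D$ be the law on $\mathbb R^d$ of a vector $x$ with independent coordinates, $\Pr(x_i=0)=1-p_i$ and $\Pr(x_i=1)=\Pr(x_i=-1)=p_i/2$. Let $x_1,\dots,x_n\sim\mathcal D$ be i.i.d. with noiseless labels $y_i=\langle\beta^*,x_i\rangle$, let $X\in\mathbb R^{n\times d}$ be the matrix with rows $x_i^\top$, and let $\hat\beta=(X^\top X)^\dagger X^\top y$ be the min-$\ell_2$-norm least-squares solution ($\dagger$ is the Moore–Penrose pseudoinverse). For $1\le k\le d$ write $p_{>k}=\sum_{k<i\le d}p_i$. There is an absolute exponent $A\in\mathbb N$ such that for all constants $0<a\le b$, $c_p>0$, $M>0$ the following hold. 1. There are $C>0$ and $d_0$, depending only on $a,b,c_p,M$, such that for all $d\ge d_0$, all $n,k\in\mathbb N$ with $\ln^A d<k$, $k\ln^A d<n$ and $n\ln^A d<d$, all $p_1,\dots,p_d$ as above with $$a\ln^2 d\le n p_k\le b\ln^2 d,\qquad p_{>k}\le 1-c_p,$$ and all $\beta^*\in\mathbb R^d$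 with $\max_i|\beta^*_i|\le M$, with probability at least $0.99$ over $X$, $$\mathbb E_{x\sim\mathcal D}\big[(\hat\beta^\top x-\beta^{*\top}x)^2\big]\le C\Big(p_{>k}+\frac{k\ln^4 d}{n^2p_{>k}}+\frac{\ln^4 d}{n}+\frac{k\,p_{>k}^2\ln^4 d}{n}+p_{>k}^3\ln^4 d\Big).$$ 2. For every $\alpha>1$ there are $C>0$ and $d_0$, depending only on $a,b,c_p,M,\alpha$, such that, whenever $d\ge d_0$, $p_i=\min\{1,\,s\,i^{-\alpha}/Z_\alpha\}$ with $Z_\alpha=\sum_{i\le d}i^{-\alpha}$ and $s>0$, and $n,k,p,\beta^*$ satisfy the conditions of part 1, with probability at least $0.99$ over $X$ both the bound of part 1 and $$\mathbb E_{x\sim\mathcal D}\big[(\hat\beta^\top x-\beta^{*\top}x)^2\big]\le C\,s\Big(\frac{\ln^2 d}{ns}\Big)^{1-1/\alpha}$$ hold. -/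

import Mathlib

open MeasureTheory Matrix

/-- The law of a single feature: `0` with probability `1 - q`, and `1`, `-1` with probability
`q / 2` each. -/
noncomputable def signLaw (q : ℝ) : Measure ℝ :=
  ENNReal.ofReal (1 - q) • Measure.dirac 0 + ENNReal.ofReal (q / 2) • Measure.dirac 1
    + ENNReal.ofReal (q / 2) • Measure.dirac (-1)

/-- The law `𝒟({p_i})` of one data vector in `ℝ^d`: independent coordinates. Features are numbered
`1, …, d` (only `p 1, …, p d` are used); feature `j + 1` is the coordinate `j : Fin d`. -/
noncomputable def featureLaw (d : ℕ) (p : ℕ → ℝ) : Measure (Fin d → ℝ) :=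
  Measure.pi fun j => signLaw (p (j + 1))

/-- The law of the `n` i.i.d. training inputs; row `i` is the `i`-th data vector. -/
noncomputable def trainLaw (n d : ℕ) (p : ℕ → ℝ) : Measure (Fin n → Fin d → ℝ) :=
  Measure.pi fun _ => featureLaw d p

/-- Admissible feature probabilities: `1 ≥ p_1 ≥ … ≥ p_d > 0`. -/
structure IsFeatureProb (d : ℕ) (p : ℕ → ℝ) : Prop where
  anti : ∀ i j : ℕ, 1 ≤ i → i ≤ j → j ≤ d → p j ≤ p i
  pos : ∀ i : ℕ, 1 ≤ i → i ≤ d → 0 < p i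
  le_one : ∀ i : ℕ, 1 ≤ i → i ≤ d → p i ≤ 1

/-- The tail probability `p_{>k} = ∑_{k < i ≤ d} p_i`. -/
noncomputable def tailProb (d : ℕ) (p : ℕ → ℝ) (k : ℕ) : ℝ :=
  ∑ i ∈ Finset.Ioc k d, p i

/-- Power-law feature probabilities `p_i = min {1, s i^{-α} / Z_α}`, `Z_α = ∑_{i ≤ d} i^{-α}`. -/
noncomputable def powerLaw (d : ℕ) (s α : ℝ) (i : ℕ) : ℝ :=
  min 1 (s * (i : ℝ) ^ (-α) / ∑ l ∈ Finset.Icc 1 d, (l : ℝ) ^ (-α))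

/-- `B` is the Moore–Penrose pseudoinverse of the real matrix `A`. -/
structure IsMoorePenrose {m n : Type*} [Fintype m] [Fintype n]
    (A : Matrix m n ℝ) (B : Matrix n m ℝ) : Prop where
  mul_mul_self : A * B * A = A
  self_mul_mul : B * A * B = B
  symm_left : (A * B)ᵀ = A * B
  symm_right : (B * A)ᵀ = B * A

theorem IsMoorePenrose.unique {m n : Type*} [Fintype m] [Fintype n]
    {A : Matrix m n ℝ} {B C : Matrix n m ℝ}
    (hB : IsMoorePenrose A B) (hC : IsMoorePenrose A C) : B = C := by
  have h1 : A * B = A * C := by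
    calc A * B = (A * B)ᵀ := hB.symm_left.symm
      _ = ((A * C) * (A * B))ᵀ := by rw [← Matrix.mul_assoc, hC.mul_mul_self]
      _ = (A * B) * (A * C) := by rw [Matrix.transpose_mul, hB.symm_left, hC.symm_left]
      _ = A * C := by rw [← Matrix.mul_assoc, hB.mul_mul_self]
  have h2 : B * A = C * A := by
    calc B * A = (B * A)ᵀ := hB.symm_right.symm
      _ = ((B * A) * (C * A))ᵀ := by
          rw [Matrix.mul_assoc, ← Matrix.mul_assoc A, hC.mul_mul_self]
      _ = (C * A) * (B * A) := by rw [Matrix.transpose_mul, hB.symm_right, hC.symm_right]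
      _ = C * A := by rw [Matrix.mul_assoc, ← Matrix.mul_assoc A, hB.mul_mul_self]
  calc B = B * A * B := hB.self_mul_mul.symm
    _ = C * A * C := by rw [h2, Matrix.mul_assoc, h1, ← Matrix.mul_assoc]
    _ = C := hC.self_mul_mul

theorem exists_isMoorePenrose_of_isHermitian {n : Type*} [Fintype n] [DecidableEq n]
    {A : Matrix n n ℝ} (hA : A.IsHermitian) : ∃ B, IsMoorePenrose A B := by
  obtain ⟨U, D, hU, hAD⟩ : ∃ (U : Matrix n n ℝ) (D : n → ℝ),
      Uᵀ * U = 1 ∧ A = U * diagonal D * Uᵀ := by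
    refine ⟨hA.eigenvectorUnitary, hA.eigenvalues, ?_, ?_⟩
    · have := Unitary.coe_star_mul_self hA.eigenvectorUnitary
      simpa [Matrix.star_eq_conjTranspose, Matrix.conjTranspose_eq_transpose_of_trivial] using this
    · have := hA.spectral_theorem
      rw [Unitary.conjStarAlgAut_apply] at this
      simpa [Matrix.star_eq_conjTranspose, Matrix.conjTranspose_eq_transpose_of_trivial,
        Function.comp_def] using this
  have key : ∀ E F : n → ℝ, (U * diagonal E * Uᵀ) * (U * diagonal F * Uᵀ)
      = U * diagonal (fun i => E i * F i) * Uᵀ := by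
    intro E F
    calc (U * diagonal E * Uᵀ) * (U * diagonal F * Uᵀ)
        = U * diagonal E * (Uᵀ * U) * diagonal F * Uᵀ := by simp only [Matrix.mul_assoc]
      _ = _ := by rw [hU, Matrix.mul_one, Matrix.mul_assoc U, Matrix.diagonal_mul_diagonal]
  have sym : ∀ E : n → ℝ, (U * diagonal E * Uᵀ)ᵀ = U * diagonal E * Uᵀ := by
    intro E
    simp [Matrix.transpose_mul, Matrix.mul_assoc]
  refine ⟨U * diagonal (fun i => (D i)⁻¹) * Uᵀ, ?_, ?_, ?_, ?_⟩
  · rw [hAD, key, key]; congr; funext i; simp [mul_inv_mul_cancel]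
  · rw [hAD, key, key]; congr; funext i
    by_cases h : D i = 0 <;> simp [h]
  · rw [hAD, key, sym]
  · rw [hAD, key, sym]

theorem exists_isMoorePenrose {m n : Type*} [Fintype m] [Fintype n]
    (A : Matrix m n ℝ) : ∃ B, IsMoorePenrose A B := by
  classical
  have hG : (Aᵀ * A).IsHermitian := by
    simpa [Matrix.conjTranspose_eq_transpose_of_trivial] using
      Matrix.isHermitian_conjTranspose_mul_self A
  obtain ⟨G, hG⟩ := exists_isMoorePenrose_of_isHermitian hG
  have hGt : Gᵀ = G := by
    refine IsMoorePenrose.unique (A := Aᵀ * A) ⟨?_, ?_, ?_, ?_⟩ hG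
    · simpa [Matrix.mul_assoc] using congrArg Matrix.transpose hG.mul_mul_self
    · simpa [Matrix.mul_assoc] using congrArg Matrix.transpose hG.self_mul_mul
    · simpa [Matrix.mul_assoc] using hG.symm_right.symm
    · simpa [Matrix.mul_assoc] using hG.symm_left.symm
  refine ⟨G * Aᵀ, ?_, ?_, ?_, ?_⟩
  · have h0 : A * (G * (Aᵀ * A) - 1) = 0 := by
      rw [← Matrix.conjTranspose_mul_self_mul_eq_zero,
        Matrix.conjTranspose_eq_transpose_of_trivial, Matrix.mul_sub, Matrix.mul_one,
        ← Matrix.mul_assoc, hG.mul_mul_self, sub_self]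
    rw [Matrix.mul_sub, Matrix.mul_one, sub_eq_zero] at h0
    simpa [Matrix.mul_assoc] using h0
  · have := congrArg (· * Aᵀ) hG.self_mul_mul
    simpa [Matrix.mul_assoc] using this
  · simp [Matrix.transpose_mul, hGt, Matrix.mul_assoc]
  · simpa [Matrix.mul_assoc] using hG.symm_right

/-- The Moore–Penrose pseudoinverse `A†`. -/
noncomputable def pinv {m n : Type*} [Fintype m] [Fintype n] (A : Matrix m n ℝ) :
    Matrix n m ℝ :=
  Classical.choose (exists_isMoorePenrose A)

/-- The min-`ℓ²`-norm least-squares solution `β̂ = (XᵀX)† Xᵀ y`. -/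
noncomputable def minNormEstimator {n d : ℕ} (X : Matrix (Fin n) (Fin d) ℝ) (y : Fin n → ℝ) :
    Fin d → ℝ :=
  pinv (Xᵀ * X) *ᵥ (Xᵀ *ᵥ y)

/-- The in-distribution test loss `E_{x ∼ 𝒟} [(bᵀx - β*ᵀx)²]` of `b` for the target `β*`. -/
noncomputable def testLoss {d : ℕ} (p : ℕ → ℝ) (βstar b : Fin d → ℝ) : ℝ :=
  ∫ x, (b ⬝ᵥ x - βstar ⬝ᵥ x) ^ 2 ∂(featureLaw d p)

/-- The test loss of the min-norm estimator trained on the inputs `X` and on the noiseless labels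
`y_i = ⟨β*, x_i⟩`. -/
noncomputable def noiselessLoss {n d : ℕ} (p : ℕ → ℝ) (βstar : Fin d → ℝ)
    (X : Fin n → Fin d → ℝ) : ℝ :=
  testLoss p βstar (minNormEstimator (Matrix.of X) fun i => βstar ⬝ᵥ X i)

/-- The general rate
`p_{>k} + k ln⁴d / (n² p_{>k}) + ln⁴d / n + k p_{>k}² ln⁴d / n + p_{>k}³ ln⁴d`. -/
noncomputable def generalRate (n d : ℕ) (p : ℕ → ℝ) (k : ℕ) : ℝ :=
  tailProb d p k + k * Real.log d ^ 4 / ((n : ℝ) ^ 2 * tailProb d p k) + Real.log d ^ 4 / n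
    + k * tailProb d p k ^ 2 * Real.log d ^ 4 / n + tailProb d p k ^ 3 * Real.log d ^ 4

/-- The power-law rate `s (ln²d / (n s))^{1 - 1/α}`. -/
noncomputable def powerLawRate (n d : ℕ) (s α : ℝ) : ℝ :=
  s * (Real.log d ^ 2 / (n * s)) ^ (1 - 1 / α)

/-- The parameter regime `polylog(d) < k < n / polylog(d) < d / polylog(d)²`, where
`polylog(d) = (ln d)^A`. -/
structure ParamRegime (A n d k : ℕ) : Prop where
  polylog_lt_k : Real.log d ^ A < k
  k_lt_n : k * Real.log d ^ A < n
  n_lt_d : n * Real.log d ^ A < d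

/-- The threshold conditions `np_k = Θ(ln²d)` (with constants `a ≤ b`) and `p_{>k} ≤ 1 - c_p`. -/
structure IsThreshold (a b cp : ℝ) (n d : ℕ) (p : ℕ → ℝ) (k : ℕ) : Prop where
  lower : a * Real.log d ^ 2 ≤ n * p k
  upper : n * p k ≤ b * Real.log d ^ 2
  tail_le : tailProb d p k ≤ 1 - cp

open ProbabilityTheory

/-! Write γ for the estimator, β for the target, P for `tailProb d p k`, L for `Real.log d`. The
coordinates are independent and centred, so the loss is Σ pᵢ(γᵢ - βᵢ)². Without noise γ
interpolates, and having minimal norm it is orthogonal to ker X.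

With high probability the rows that vanish on all tail features (i > k) already determine the head,
so γ = β there. A tail feature that never occurs has γᵢ = 0; one that occurs, but never together
with another tail feature, is read off exactly from a row. These contribute at most M²P. On the set
W of colliding tail features the error restricted to W lies in ker X, hence is orthogonal to γ, and
its squared norm is at most M²|W|; each weight there is at most p_k (`sum_mul_sq_error_le`). Since
E|W| ≤ nP² and np_k ≤ bL², Markov's inequality gives a loss of order P + L²P², and AM-GM bounds L²P²
by the first and last terms of the general rate.

Identifying the head is the probabilistic core. The entries are integers, so injectivity modulo 3
suffices (`int_matrix_mulVec_injective_of_mod_three`). This leaves finitely many candidate kernel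
vectors, and a union bound in which vectors with few nonzero entries are weighed by their support
handles them (`measureReal_hasModThreeKernel_le`).

For the power law, P is at most a constant times k p_k, hence of the order of the claimed rate, and
L²P is bounded, so the quadratic term is absorbed. -/

/-! ### Two properties of the estimator: interpolation and orthogonality to the kernel. -/

theorem mulVec_minNormEstimator {n d : ℕ} (X : Matrix (Fin n) (Fin d) ℝ) (β : Fin d → ℝ) :
    X *ᵥ minNormEstimator X (X *ᵥ β) = X *ᵥ β := by
  have h := (Classical.choose_spec (exists_isMoorePenrose (Xᵀ * X))).mul_mul_self
  have h0 : X * (pinv (Xᵀ * X) * (Xᵀ * X) - 1) = 0 := by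
    rw [← Matrix.conjTranspose_mul_self_mul_eq_zero,
      Matrix.conjTranspose_eq_transpose_of_trivial, Matrix.mul_sub, Matrix.mul_one,
      ← Matrix.mul_assoc, sub_eq_zero]
    exact h
  rw [Matrix.mul_sub, Matrix.mul_one, sub_eq_zero] at h0
  unfold minNormEstimator
  conv_rhs => rw [← h0]
  simp [Matrix.mulVec_mulVec]

/-- The estimator is (XᵀX)†(XᵀX)β, and this matrix is symmetric and annihilates ker X. -/
theorem minNormEstimator_dotProduct_of_mulVec_eq_zero {n d : ℕ} (X : Matrix (Fin n) (Fin d) ℝ)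
    (β z : Fin d → ℝ) (hz : X *ᵥ z = 0) : minNormEstimator X (X *ᵥ β) ⬝ᵥ z = 0 := by
  have h := (Classical.choose_spec (exists_isMoorePenrose (Xᵀ * X))).symm_right
  change (pinv (Xᵀ * X) * (Xᵀ * X))ᵀ = pinv (Xᵀ * X) * (Xᵀ * X) at h
  have : minNormEstimator X (X *ᵥ β) = (pinv (Xᵀ * X) * (Xᵀ * X)) *ᵥ β := by
    simp [minNormEstimator, Matrix.mulVec_mulVec]
  rw [this, ← h, Matrix.mulVec_transpose, ← Matrix.dotProduct_mulVec]
  simp [← Matrix.mulVec_mulVec, hz]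

/-! ### From residues modulo 3 to the reals. -/

/-- Infinite descent: an integer kernel vector vanishes modulo 3, so it is divisible by 3 and the
quotient is again in the kernel. A real kernel vector yields an integer one through the determinant
of the Gram matrix. -/
theorem int_matrix_mulVec_injective_of_mod_three {m n : Type*} [Fintype m] [Fintype n]
    (Z : Matrix m n ℤ)
    (h : ∀ v : n → ZMod 3, Z.map (Int.cast : ℤ → ZMod 3) *ᵥ v = 0 → v = 0)
    (x : n → ℝ) (hx : Z.map (Int.cast : ℤ → ℝ) *ᵥ x = 0) : x = 0 := by
  classical
  have descent : ∀ N : ℕ, ∀ v : n → ℤ, Z *ᵥ v = 0 → (∑ i, (v i).natAbs) ≤ N → v = 0 := by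
    intro N
    induction N using Nat.strong_induction_on with
    | _ N ih =>
      intro v hv hN
      by_contra hne
      have h3 : (fun i => (v i : ZMod 3)) = 0 := by
        apply h
        funext r
        have := congrArg (Int.cast : ℤ → ZMod 3) (congrFun hv r)
        simpa [Matrix.mulVec, dotProduct] using this
      have hdvd : ∀ i, ∃ w : ℤ, v i = 3 * w := fun i => by
        have := congrFun h3 i
        exact (ZMod.intCast_zmod_eq_zero_iff_dvd (v i) 3).1 this
      choose w hw using hdvd
      have hvw : v = (3 : ℤ) • w := by funext i; simp [hw i]
      have hZw : Z *ᵥ w = 0 := by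
        rw [hvw, Matrix.mulVec_smul] at hv
        exact (smul_eq_zero.1 hv).resolve_left (by norm_num)
      have hsum : ∑ i, (v i).natAbs = 3 * ∑ i, (w i).natAbs := by
        simp [Finset.mul_sum, hw, Int.natAbs_mul]
      have hpos : 0 < ∑ i, (v i).natAbs := by
        rw [Finset.sum_pos_iff]
        obtain ⟨i, hi⟩ := Function.ne_iff.1 hne
        exact ⟨i, Finset.mem_univ _, Int.natAbs_pos.2 hi⟩
      have hw0 := ih (∑ i, (w i).natAbs) (by omega) w hZw le_rfl
      exact hne (by rw [hvw, hw0, smul_zero])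
  by_contra hne
  -- The Gram matrix is square, so singularity is the vanishing of an integer, which does not depend
  -- on whether it is read in ℝ or in ℤ.
  have hdet : ((Zᵀ * Z).map (Int.cast : ℤ → ℝ)).det = 0 := by
    refine Matrix.exists_mulVec_eq_zero_iff.1 ⟨x, hne, ?_⟩
    have : (Zᵀ * Z).map (Int.cast : ℤ → ℝ)
        = (Z.map (Int.cast : ℤ → ℝ))ᵀ * Z.map (Int.cast : ℤ → ℝ) := by
      ext i j; simp [Matrix.mul_apply]
    rw [this, ← Matrix.mulVec_mulVec, hx, Matrix.mulVec_zero]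
  have hdet' : (Zᵀ * Z).det = 0 := by
    have := (Int.castRingHom ℝ).map_det (Zᵀ * Z)
    rw [RingHom.mapMatrix_apply] at this
    exact Int.cast_eq_zero.1 (this.trans hdet)
  obtain ⟨v, hv, hv0⟩ := Matrix.exists_mulVec_eq_zero_iff.2 hdet'
  refine hv (descent _ v ?_ le_rfl)
  have : (Z *ᵥ v) ⬝ᵥ (Z *ᵥ v) = 0 := by
    rw [Matrix.dotProduct_mulVec, ← Matrix.mulVec_transpose, Matrix.mulVec_mulVec, hv0,
      zero_dotProduct]
  exact dotProduct_self_eq_zero.1 this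

/-! ### Deterministic error bound. -/

open Classical in
/-- The features outside `S` that co-occur in some row with another feature outside `S`. -/
noncomputable def collisions {ρ ι : Type*} [Fintype ι] (S : Finset ι) (X : ρ → ι → ℝ) : Finset ι :=
  {i | i ∉ S ∧ ∃ r, ∃ j, j ∉ S ∧ j ≠ i ∧ X r i ≠ 0 ∧ X r j ≠ 0}

/-- Here γ is an interpolator orthogonal to ker X, and `hS` says that the rows free of tail features
determine the head. The first term pays for tail features outside the collision set, the second for
the colliding ones. -/
theorem sum_mul_sq_error_le {ρ ι : Type*} [Fintype ι] (S : Finset ι) [DecidablePred (· ∉ S)] (X : Matrix ρ ι ℝ)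
    (q β γ : ι → ℝ) (M π : ℝ) (hq : ∀ i, 0 ≤ q i) (hπ : ∀ i, i ∉ S → q i ≤ π)
    (hβ : ∀ i, |β i| ≤ M) (hXγ : X *ᵥ γ = X *ᵥ β) (hker : ∀ z, X *ᵥ z = 0 → γ ⬝ᵥ z = 0)
    (hS : ∀ z : ι → ℝ, (∀ r, (∀ i, i ∉ S → X r i = 0) → ∑ i, X r i * z i = 0) →
      ∀ i ∈ S, z i = 0) :
    ∑ i, q i * (γ i - β i) ^ 2 ≤
      M ^ 2 * ∑ i ∈ Finset.univ.filter (· ∉ S), q i + π * M ^ 2 * (collisions S X).card := by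
  classical
  have hδ : ∀ r, ∑ i, X r i * (γ i - β i) = 0 := by
    intro r
    have := congrFun hXγ r
    simp only [Matrix.mulVec, dotProduct] at this
    simp [mul_sub, this]
  have hhead : ∀ i ∈ S, γ i - β i = 0 := hS (fun i => γ i - β i) fun r _ => hδ r
  have hβ2 : ∀ i, β i ^ 2 ≤ M ^ 2 := fun i => sq_le_sq' (abs_le.1 (hβ i)).1 (abs_le.1 (hβ i)).2
  set W := collisions S X with hW
  have hmemW : ∀ i, i ∈ W ↔ i ∉ S ∧ ∃ r, ∃ j, j ∉ S ∧ j ≠ i ∧ X r i ≠ 0 ∧ X r j ≠ 0 := by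
    intro i; simp [hW, collisions]
  -- In such a row every other term vanishes: head errors are zero and no other tail feature is
  -- present.
  have hzero : ∀ i, i ∉ W → ∀ r, X r i ≠ 0 → γ i - β i = 0 := by
    intro i hi r hr
    by_cases hiS : i ∈ S
    · exact hhead i hiS
    have : ∑ j, X r j * (γ j - β j) = X r i * (γ i - β i) := by
      refine Finset.sum_eq_single i (fun j _ hji => ?_) (by simp)
      by_cases hjS : j ∈ S
      · rw [hhead j hjS, mul_zero]
      · by_cases hj : X r j = 0
        · rw [hj, zero_mul]
        · exact absurd ((hmemW i).2 ⟨hiS, r, j, hjS, hji, hr, hj⟩) hi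
    rw [hδ r] at this
    exact (mul_eq_zero.1 this.symm).resolve_left hr
  have hout : ∀ i, i ∉ W → (γ i - β i) ^ 2 ≤ M ^ 2 := by
    intro i hi
    by_cases h : ∃ r, X r i ≠ 0
    · obtain ⟨r, hr⟩ := h
      rw [hzero i hi r hr]
      simpa using sq_nonneg M
    · push Not at h
      have : γ i = 0 := by
        have := hker (Pi.single i 1) (by funext r; simp [h r])
        simpa using this
      simpa [this] using hβ2 i
  -- By `hzero` each row meets the error only inside W, so cutting the error off outside W leaves it
  -- in ker X.
  have horth : ∑ i ∈ W, γ i * (γ i - β i) = 0 := by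
    have := hker (fun i => if i ∈ W then γ i - β i else 0) (by
      funext r
      simp only [Matrix.mulVec, dotProduct, Pi.zero_apply]
      refine Eq.trans ?_ (hδ r)
      refine Finset.sum_congr rfl fun i _ => ?_
      by_cases hi : i ∈ W
      · simp [hi]
      · by_cases hr : X r i = 0
        · simp [hr]
        · rw [if_neg hi, hzero i hi r hr])
    simpa [dotProduct, Finset.sum_ite_mem] using this
  -- Pythagoras on W: ‖γ - β‖² = ‖β‖² - ‖γ‖².
  have hsumW : ∑ i ∈ W, (γ i - β i) ^ 2 ≤ M ^ 2 * W.card := by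
    calc ∑ i ∈ W, (γ i - β i) ^ 2
        = ∑ i ∈ W, (β i ^ 2 - γ i ^ 2) + 2 * ∑ i ∈ W, γ i * (γ i - β i) := by
          rw [Finset.mul_sum, ← Finset.sum_add_distrib]
          exact Finset.sum_congr rfl fun i _ => by ring
      _ ≤ ∑ i ∈ W, M ^ 2 := by
          rw [horth, mul_zero, add_zero]
          exact Finset.sum_le_sum fun i _ => by nlinarith [hβ2 i, sq_nonneg (γ i)]
      _ = _ := by simp [mul_comm]
  have hpoint : ∀ i, q i * (γ i - β i) ^ 2 ≤
      (if i ∉ S then M ^ 2 * q i else 0) + (if i ∈ W then π * (γ i - β i) ^ 2 else 0) := by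
    intro i
    by_cases hiS : i ∈ S
    · have hiW : i ∉ W := fun h => ((hmemW i).1 h).1 hiS
      simp [hiS, hiW, hhead i hiS]
    · by_cases hiW : i ∈ W
      · simp only [hiS, hiW, not_false_eq_true, if_true]
        nlinarith [mul_le_mul_of_nonneg_right (hπ i hiS) (sq_nonneg (γ i - β i)),
          mul_nonneg (sq_nonneg M) (hq i)]
      · simp only [hiS, hiW, not_false_eq_true, if_true, if_false, add_zero]
        nlinarith [mul_le_mul_of_nonneg_left (hout i hiW) (hq i)]
  have hWπ : W.Nonempty → 0 ≤ π := fun ⟨i, hi⟩ => (hq i).trans (hπ i ((hmemW i).1 hi).1)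
  calc ∑ i, q i * (γ i - β i) ^ 2
      ≤ ∑ i, ((if i ∉ S then M ^ 2 * q i else 0)
          + (if i ∈ W then π * (γ i - β i) ^ 2 else 0)) := Finset.sum_le_sum fun i _ => hpoint i
    _ = M ^ 2 * ∑ i ∈ Finset.univ.filter (· ∉ S), q i + π * ∑ i ∈ W, (γ i - β i) ^ 2 := by
        rw [Finset.sum_add_distrib, ← Finset.sum_filter, ← Finset.mul_sum, ← Finset.sum_filter,
          ← Finset.mul_sum]
        simp
    _ ≤ _ := by
        rcases W.eq_empty_or_nonempty with h | h
        · simp [h]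
        · nlinarith [mul_le_mul_of_nonneg_left hsumW (hWπ h)]

/-! ### The law of one feature and the second moment of a linear form. -/

theorem isProbabilityMeasure_signLaw {q : ℝ} (h0 : 0 ≤ q) (h1 : q ≤ 1) :
    IsProbabilityMeasure (signLaw q) := by
  constructor
  simp only [signLaw, Measure.coe_add, Measure.coe_smul, Pi.add_apply, Pi.smul_apply,
    measure_univ, smul_eq_mul, mul_one]
  rw [← ENNReal.ofReal_add (by linarith) (by linarith),
    ← ENNReal.ofReal_add (by linarith) (by linarith)]
  rw [show 1 - q + q / 2 + q / 2 = 1 by ring, ENNReal.ofReal_one]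

theorem measureReal_signLaw {q : ℝ} (h0 : 0 ≤ q) (h1 : q ≤ 1) {A : Set ℝ}
    (hA : MeasurableSet A) :
    (signLaw q).real A = (1 - q) * A.indicator 1 0 + q / 2 * A.indicator 1 1
      + q / 2 * A.indicator 1 (-1) := by
  have key : ∀ x : ℝ, Measure.dirac x A = ENNReal.ofReal (A.indicator 1 x) := by
    intro x
    rw [Measure.dirac_apply' _ hA]
    by_cases hx : x ∈ A <;> simp [hx]
  have hi : ∀ x : ℝ, (0 : ℝ) ≤ A.indicator 1 x := fun x =>
    Set.indicator_nonneg (fun _ _ => zero_le_one) x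
  have a1 := mul_nonneg (sub_nonneg.2 h1) (hi 0)
  have a2 := mul_nonneg (half_pos_nonneg h0) (hi 1)
  have a3 := mul_nonneg (half_pos_nonneg h0) (hi (-1))
  simp only [measureReal_def, signLaw, Measure.coe_add, Measure.coe_smul, Pi.add_apply,
    Pi.smul_apply, smul_eq_mul, key]
  rw [← ENNReal.ofReal_mul (by linarith), ← ENNReal.ofReal_mul (by linarith),
    ← ENNReal.ofReal_mul (by linarith), ← ENNReal.ofReal_add a1 a2,
    ← ENNReal.ofReal_add (by linarith) a3, ENNReal.toReal_ofReal (by linarith)]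
where
  half_pos_nonneg {q : ℝ} (h : 0 ≤ q) : 0 ≤ q / 2 := by linarith

theorem integral_signLaw {q : ℝ} (h0 : 0 ≤ q) (h1 : q ≤ 1) (f : ℝ → ℝ) :
    ∫ x, f x ∂(signLaw q) = (1 - q) * f 0 + q / 2 * f 1 + q / 2 * f (-1) := by
  have hint : ∀ x c, Integrable f (ENNReal.ofReal c • Measure.dirac x) := fun x c =>
    (integrable_dirac (by simp)).smul_measure (by simp)
  rw [signLaw, integral_add_measure ((hint _ _).add_measure (hint _ _)) (hint _ _),
    integral_add_measure (hint _ _) (hint _ _)]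
  simp only [integral_smul_measure, integral_dirac, smul_eq_mul]
  rw [ENNReal.toReal_ofReal (by linarith), ENNReal.toReal_ofReal (by linarith)]

/-- The integer value of a feature in `{0, 1, -1}`. -/
noncomputable def signPart (x : ℝ) : ℤ := if x = 1 then 1 else if x = -1 then -1 else 0

theorem measurable_signPart : Measurable signPart :=
  Measurable.ite (measurableSet_singleton 1) measurable_const
    (Measurable.ite (measurableSet_singleton (-1)) measurable_const measurable_const)

theorem signPart_zero : signPart 0 = 0 := by norm_num [signPart]
theorem signPart_one : signPart 1 = 1 := by norm_num [signPart]
theorem signPart_neg_one : signPart (-1) = -1 := by norm_num [signPart]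

theorem ae_signLaw_eq_signPart (q : ℝ) : ∀ᵐ x ∂(signLaw q), x = signPart x := by
  have hm : MeasurableSet {x : ℝ | x = signPart x} :=
    measurableSet_eq_fun measurable_id (measurable_from_top.comp measurable_signPart)
  have key : ∀ (c : ENNReal) (y : ℝ), y = signPart y →
      ∀ᵐ x ∂(c • Measure.dirac y), x = signPart x := fun c y hy =>
    Measure.ae_smul_measure ((ae_dirac_iff hm).2 hy) c
  rw [signLaw, ae_add_measure_iff, ae_add_measure_iff]
  exact ⟨⟨key _ _ (by simp [signPart_zero]), key _ _ (by simp [signPart_one])⟩,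
    key _ _ (by simp [signPart_neg_one])⟩

theorem memLp_two_signLaw {q : ℝ} (h0 : 0 ≤ q) (h1 : q ≤ 1) (c : ℝ) :
    MemLp (fun x : ℝ => c * x) 2 (signLaw q) := by
  have := isProbabilityMeasure_signLaw h0 h1
  refine MemLp.of_bound (by fun_prop) |c| ?_
  filter_upwards [ae_signLaw_eq_signPart q] with x hx
  rw [Real.norm_eq_abs, abs_mul]
  have : |x| ≤ 1 := by
    rw [hx]; unfold signPart; split_ifs <;> simp
  nlinarith [abs_nonneg c]

theorem integral_sq_sum_signLaw {ι : Type*} [Fintype ι] (q c : ι → ℝ) (h0 : ∀ i, 0 ≤ q i)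
    (h1 : ∀ i, q i ≤ 1) :
    ∫ x, (∑ i, c i * x i) ^ 2 ∂(Measure.pi fun i => signLaw (q i)) = ∑ i, q i * c i ^ 2 := by
  have := fun i => isProbabilityMeasure_signLaw (h0 i) (h1 i)
  have hL : ∀ i, MemLp (fun x : ℝ => c i * x) 2 (signLaw (q i)) :=
    fun i => memLp_two_signLaw (h0 i) (h1 i) (c i)
  have hmean : ∫ x, (∑ i, c i * x i) ∂(Measure.pi fun i => signLaw (q i)) = 0 := by
    rw [integral_finsetSum]
    · refine Finset.sum_eq_zero fun i _ => ?_
      rw [integral_comp_eval (μ := fun i => signLaw (q i)) (f := fun x => c i * x)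
        (hL i).aestronglyMeasurable, integral_signLaw (h0 i) (h1 i)]
      ring
    · exact fun i _ => ((hL i).comp_measurePreserving
        (measurePreserving_eval (fun i => signLaw (q i)) i)).integrable one_le_two
  have hvar := variance_sum_pi (μ := fun i => signLaw (q i)) hL
  have hfun : (∑ i, fun ω : ι → ℝ => c i * ω i) = fun ω => ∑ i, c i * ω i := by
    funext ω; simp
  rw [hfun, variance_of_integral_eq_zero
    (Finset.measurable_fun_sum _ fun i _ => (measurable_pi_apply i).const_mul _).aemeasurable hmean] at hvar
  rw [hvar]
  refine Finset.sum_congr rfl fun i _ => ?_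
  rw [variance_of_integral_eq_zero (by fun_prop)]
  · rw [integral_signLaw (h0 i) (h1 i)]; ring
  · rw [integral_signLaw (h0 i) (h1 i)]; ring

/-! ### Probability that one row detects a vector modulo 3. -/

section Row

variable {ι : Type*} [Fintype ι] {q : ι → ℝ}

theorem measureReal_pi_signLaw_eval (h0 : ∀ i, 0 ≤ q i) (h1 : ∀ i, q i ≤ 1) (i : ι) {A : Set ℝ}
    (hA : MeasurableSet A) :
    (Measure.pi fun i => signLaw (q i)).real {x | x i ∈ A} = (signLaw (q i)).real A := by
  have := fun i => isProbabilityMeasure_signLaw (h0 i) (h1 i)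
  have := (measurePreserving_eval (fun i => signLaw (q i)) i).measure_preimage hA.nullMeasurableSet
  rw [measureReal_def, measureReal_def, ← this]
  rfl

theorem measureReal_ne_zero (h0 : ∀ i, 0 ≤ q i) (h1 : ∀ i, q i ≤ 1) (i : ι) :
    (Measure.pi fun i => signLaw (q i)).real {x | x i ≠ 0} = q i := by
  have := measureReal_pi_signLaw_eval h0 h1 i (A := {0}ᶜ) (measurableSet_singleton 0).compl
  rw [measureReal_signLaw (h0 i) (h1 i) (measurableSet_singleton 0).compl] at this
  refine this.trans ?_
  simp

theorem measureReal_ne_zero_and_ne_zero (h0 : ∀ i, 0 ≤ q i) (h1 : ∀ i, q i ≤ 1) {i j : ι}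
    (hij : i ≠ j) :
    (Measure.pi fun i => signLaw (q i)).real {x | x i ≠ 0 ∧ x j ≠ 0} = q i * q j := by
  have := fun i => isProbabilityMeasure_signLaw (h0 i) (h1 i)
  have hind := (iIndepFun_pi (μ := fun i => signLaw (q i)) (X := fun _ x => x)
    fun i => aemeasurable_id).indepFun hij
  have := hind.measure_inter_preimage_eq_mul {0}ᶜ {0}ᶜ (measurableSet_singleton 0).compl
    (measurableSet_singleton 0).compl
  rw [← measureReal_ne_zero h0 h1 i, ← measureReal_ne_zero h0 h1 j]
  simp only [measureReal_def]
  rw [← ENNReal.toReal_mul]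
  exact congrArg _ this

theorem le_measureReal_forall_notMem_eq_zero (h0 : ∀ i, 0 ≤ q i) (h1 : ∀ i, q i ≤ 1)
    (S : Finset ι) [DecidablePred (· ∉ S)] :
    1 - ∑ i ∈ Finset.univ.filter (· ∉ S), q i ≤
      (Measure.pi fun i => signLaw (q i)).real {x | ∀ i, i ∉ S → x i = 0} := by
  have := fun i => isProbabilityMeasure_signLaw (h0 i) (h1 i)
  set μ := Measure.pi fun i => signLaw (q i)
  have hm : MeasurableSet {x : ι → ℝ | ∀ i, i ∉ S → x i = 0} := by
    simp only [Set.ofPred_forall]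
    exact MeasurableSet.iInter fun i => MeasurableSet.iInter fun _ =>
      measurableSet_eq_fun (measurable_pi_apply i) measurable_const
  have hc : μ.real {x | ∀ i, i ∉ S → x i = 0}ᶜ ≤ ∑ i ∈ Finset.univ.filter (· ∉ S), q i := by
    calc μ.real {x | ∀ i, i ∉ S → x i = 0}ᶜ
        ≤ μ.real (⋃ i ∈ Finset.univ.filter (· ∉ S), {x | x i ≠ 0}) := by
          refine measureReal_mono (fun x hx => ?_) (measure_ne_top _ _)
          simp only [Set.mem_compl_iff, Set.mem_ofPred_eq, not_forall] at hx
          obtain ⟨i, hi, hx⟩ := hx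
          simp only [Set.mem_iUnion]
          exact ⟨i, by simpa using hi, hx⟩
      _ ≤ ∑ i ∈ Finset.univ.filter (· ∉ S), μ.real {x | x i ≠ 0} := measureReal_biUnion_finset_le _ _
      _ = _ := Finset.sum_congr rfl fun i _ => measureReal_ne_zero h0 h1 i
  rw [measureReal_compl hm] at hc
  simp only [probReal_univ] at hc
  linarith

/-- If X ≠ 0, the sum vanishes only when Y = -X, of probability p / 2; if X = 0, the sum is nonzero
with probability p. Mixing the two cases gives the formula. -/
theorem measureReal_add_ne_zero {Ω : Type*} [MeasurableSpace Ω] {μ : Measure Ω}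
    [IsProbabilityMeasure μ] [MeasurableSpace (ZMod 3)] [DiscreteMeasurableSpace (ZMod 3)]
    {X Y : Ω → ZMod 3} (hX : Measurable X) (hY : Measurable Y) (hXY : IndepFun X Y μ) {p : ℝ}
    (h0 : μ.real {ω | Y ω = 0} = 1 - p) (h1 : μ.real {ω | Y ω = 1} = p / 2)
    (h2 : μ.real {ω | Y ω = 2} = p / 2) :
    μ.real {ω | X ω + Y ω ≠ 0} = p + μ.real {ω | X ω ≠ 0} * (1 - 3 * p / 2) := by
  have hmX : ∀ c, MeasurableSet {ω | X ω = c} := fun c => hX (measurableSet_singleton c)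
  have hmY : ∀ c, MeasurableSet {ω | Y ω = c} := fun c => hY (measurableSet_singleton c)
  have hprod : ∀ b c, μ.real ({ω | X ω = b} ∩ {ω | Y ω = c})
      = μ.real {ω | X ω = b} * μ.real {ω | Y ω = c} := fun b c => by
    have := hXY.measure_inter_preimage_eq_mul {b} {c} (measurableSet_singleton b)
      (measurableSet_singleton c)
    simp only [measureReal_def]
    rw [← ENNReal.toReal_mul]
    exact congrArg _ this
  have hsplit : {ω | X ω + Y ω = 0} = ({ω | X ω = 0} ∩ {ω | Y ω = 0}) ∪
      (({ω | X ω = 2} ∩ {ω | Y ω = 1}) ∪ ({ω | X ω = 1} ∩ {ω | Y ω = 2})) := by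
    ext ω
    simp only [Set.mem_ofPred_eq, Set.mem_union, Set.mem_inter_iff]
    generalize X ω = u; generalize Y ω = v
    revert u v; decide
  have hdisj : ∀ b c b' c', (c : ZMod 3) ≠ c' →
      Disjoint ({ω | X ω = b} ∩ {ω | Y ω = c}) ({ω | X ω = b'} ∩ {ω | Y ω = c'}) := by
    intro b c b' c' h
    rw [Set.disjoint_left]
    rintro ω ⟨_, h3⟩ ⟨_, h4⟩
    exact h (h3.symm.trans h4)
  have hz : μ.real {ω | X ω + Y ω = 0} = μ.real {ω | X ω = 0} * (1 - p)
      + (μ.real {ω | X ω = 2} * (p / 2) + μ.real {ω | X ω = 1} * (p / 2)) := by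
    rw [hsplit, measureReal_union
        ((hdisj _ _ _ _ (by decide)).union_right (hdisj _ _ _ _ (by decide)))
        (((hmX _).inter (hmY _)).union ((hmX _).inter (hmY _))),
      measureReal_union (hdisj _ _ _ _ (by decide)) ((hmX _).inter (hmY _)),
      hprod, hprod, hprod, h0, h1, h2]
  have hX12 : μ.real {ω | X ω ≠ 0} = μ.real {ω | X ω = 1} + μ.real {ω | X ω = 2} := by
    rw [← measureReal_union _ (hmX _)]
    · congr 1
      ext ω
      simp only [Set.mem_ofPred_eq, Set.mem_union]
      generalize X ω = u
      revert u; decide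
    · rw [Set.disjoint_left]
      intro ω h3 h4
      exact absurd (h3.symm.trans h4) (by decide)
  have hc1 : μ.real {ω | X ω + Y ω ≠ 0} = 1 - μ.real {ω | X ω + Y ω = 0} := by
    exact probReal_compl_eq_one_sub ((hX.add hY) (measurableSet_singleton 0))
  have hc2 : μ.real {ω | X ω ≠ 0} = 1 - μ.real {ω | X ω = 0} := by
    exact probReal_compl_eq_one_sub (hmX 0)
  rw [hc1, hz]
  have e1 : μ.real {ω | X ω = 0} = 1 - (μ.real {ω | X ω = 1} + μ.real {ω | X ω = 2}) := by
    linarith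
  rw [hX12, e1]
  ring

/-- Adding one coordinate at a time, the probability Q of a nonzero sum obeys the recursion of
`measureReal_add_ne_zero`. The random signs matter: modulo 2 a feature with q = 1 would be
deterministic and the sum could vanish surely. -/
theorem min_le_measureReal_sum_ne_zero (h0 : ∀ i, 0 ≤ q i) (h1 : ∀ i, q i ≤ 1) {π : ℝ}
    (T : Finset ι) (v : ι → ZMod 3) (hπ : ∀ i ∈ T, π ≤ q i)
    (hv : ∀ i ∈ T, v i ≠ 0) :
    min (1 / 3) (T.card * (π / 2)) ≤
      (Measure.pi fun i => signLaw (q i)).real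
        {x | ∑ i ∈ T, (signPart (x i) : ZMod 3) * v i ≠ 0} := by
  classical
  have := fun i => isProbabilityMeasure_signLaw (h0 i) (h1 i)
  let _ : MeasurableSpace (ZMod 3) := ⊤
  have hmf : ∀ i, Measurable fun y : ℝ => (signPart y : ZMod 3) * v i := fun i =>
    (measurable_from_top (f := fun z : ℤ => (z : ZMod 3) * v i)).comp measurable_signPart
  have hmf' : ∀ i, Measurable fun x : ι → ℝ => (signPart (x i) : ZMod 3) * v i := fun i =>
    (hmf i).comp (measurable_pi_apply i)
  have hind : iIndepFun (fun i (x : ι → ℝ) => (signPart (x i) : ZMod 3) * v i)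
      (Measure.pi fun i => signLaw (q i)) := iIndepFun_pi fun i => (hmf i).aemeasurable
  induction T using Finset.induction_on with
  | empty => simp
  | insert a T ha ih =>
    have ih := ih (fun i hi => hπ i (Finset.mem_insert_of_mem hi))
      fun i hi => hv i (Finset.mem_insert_of_mem hi)
    have hlaw : ∀ c : ZMod 3, (Measure.pi fun i => signLaw (q i)).real
        {x | (signPart (x a) : ZMod 3) * v a = c}
        = (1 - q a) * (if (0 : ZMod 3) = c then 1 else 0)
          + q a / 2 * (if v a = c then 1 else 0) + q a / 2 * (if -v a = c then 1 else 0) := by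
      intro c
      have hA : MeasurableSet {y : ℝ | (signPart y : ZMod 3) * v a = c} :=
        hmf a (measurableSet_singleton c)
      have := measureReal_pi_signLaw_eval h0 h1 a hA
      rw [measureReal_signLaw (h0 a) (h1 a) hA] at this
      refine this.trans ?_
      simp [Set.indicator_apply, signPart_zero, signPart_one, signPart_neg_one]
    have hva := hv a (Finset.mem_insert_self _ _)
    have hva' : v a = 1 ∨ v a = 2 := by
      revert hva; generalize v a = u; revert u; decide
    have hstep := measureReal_add_ne_zero (μ := Measure.pi fun i => signLaw (q i)) (p := q a)
      (X := fun x => ∑ i ∈ T, (signPart (x i) : ZMod 3) * v i)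
      (Y := fun x => (signPart (x a) : ZMod 3) * v a)
      (Finset.measurable_fun_sum _ fun i _ => hmf' i) (hmf' a)
      (by
        have := hind.indepFun_finsetSum_of_notMem hmf' ha
        convert this using 1
        funext x; simp)
      (by rw [hlaw]; rcases hva' with h | h <;> rw [h] <;>
            simp [show (1 : ZMod 3) ≠ 0 by decide, show (2 : ZMod 3) ≠ 0 by decide])
      (by rw [hlaw]; rcases hva' with h | h <;> rw [h] <;>
            simp [show (0 : ZMod 3) ≠ 1 by decide, show (2 : ZMod 3) ≠ 1 by decide,
              show (-1 : ZMod 3) ≠ 1 by decide, show (-2 : ZMod 3) = 1 by decide])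
      (by rw [hlaw]; rcases hva' with h | h <;> rw [h] <;>
            simp [show (0 : ZMod 3) ≠ 2 by decide, show (1 : ZMod 3) ≠ 2 by decide,
              show (-2 : ZMod 3) ≠ 2 by decide, show (-1 : ZMod 3) = 2 by decide])
    have hset : {x : ι → ℝ | ∑ i ∈ insert a T, (signPart (x i) : ZMod 3) * v i ≠ 0}
        = {x | ∑ i ∈ T, (signPart (x i) : ZMod 3) * v i + (signPart (x a) : ZMod 3) * v a ≠ 0} := by
      ext x; rw [Set.mem_ofPred_eq, Set.mem_ofPred_eq, Finset.sum_insert ha, add_comm]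
    rw [hset, hstep, Finset.card_insert_of_notMem ha]
    set Q := (Measure.pi fun i => signLaw (q i)).real
      {x | ∑ i ∈ T, (signPart (x i) : ZMod 3) * v i ≠ 0}
    have hQ1 : Q ≤ 1 := measureReal_le_one
    have hπa := hπ a (Finset.mem_insert_self _ _)
    have h0a := h0 a
    have h1a := h1 a
    push_cast
    -- Below 1/3 a step gains at least q / 2. Above 1/3 the new value is affine in q, with end
    -- values Q at q = 0 and 1 - Q / 2 at q = 1, so it stays above 1/3.
    rcases le_total Q (1 / 3) with hQ | hQ
    · have : q a / 2 + Q ≤ q a + Q * (1 - 3 * q a / 2) := by nlinarith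
      rcases min_le_iff.1 ih with h | h
      · exact (min_le_left _ _).trans (by linarith)
      · exact (min_le_right _ _).trans (by linarith)
    · exact (min_le_left _ _).trans (by nlinarith)

/-- The tail is empty with probability at least c by a union bound, and this event involves
coordinates disjoint from the support of v, so the two probabilities multiply. -/
theorem le_measureReal_row (h0 : ∀ i, 0 ≤ q i) (h1 : ∀ i, q i ≤ 1) {π c : ℝ}
    (hπ0 : 0 ≤ π) (S : Finset ι) [DecidablePred (· ∉ S)] (v : ι → ZMod 3) (hπ : ∀ i ∈ S, π ≤ q i)
    (hv : ∀ i, i ∉ S → v i = 0) (htail : ∑ i ∈ Finset.univ.filter (· ∉ S), q i ≤ 1 - c) :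
    c * min (1 / 3) ((Finset.univ.filter (fun i => v i ≠ 0)).card * (π / 2)) ≤
      (Measure.pi fun i => signLaw (q i)).real
        {x | (∀ i, i ∉ S → x i = 0) ∧ ∑ i, (signPart (x i) : ZMod 3) * v i ≠ 0} := by
  classical
  have := fun i => isProbabilityMeasure_signLaw (h0 i) (h1 i)
  set T := Finset.univ.filter (fun i => v i ≠ 0) with hT
  have hTS : ∀ i ∈ T, i ∈ S := fun i hi => by
    by_contra h
    exact (Finset.mem_filter.1 hi).2 (hv i h)
  have hA := le_measureReal_forall_notMem_eq_zero h0 h1 S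
  have hB := min_le_measureReal_sum_ne_zero h0 h1 T v (fun i hi => hπ i (hTS i hi))
    fun i hi => (Finset.mem_filter.1 hi).2
  have hdisj : Disjoint Sᶜ T :=
    Finset.disjoint_left.2 fun i hi hiT => Finset.mem_compl.1 hi (hTS i hiT)
  have hind := (iIndepFun_pi (μ := fun i => signLaw (q i)) (X := fun _ x => x)
    fun i => aemeasurable_id).indepFun_finset Sᶜ T hdisj fun i => measurable_pi_apply i
  have hmA : MeasurableSet {y : (Sᶜ : Finset ι) → ℝ | ∀ i, y i = 0} := by
    simp only [Set.ofPred_forall]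
    exact MeasurableSet.iInter fun i =>
      measurableSet_eq_fun (measurable_pi_apply i) measurable_const
  have hmB : MeasurableSet {y : T → ℝ | ∑ i, (signPart (y i) : ZMod 3) * v i ≠ 0} := by
    let _ : MeasurableSpace (ZMod 3) := ⊤
    have : Measurable fun y : T → ℝ => ∑ i, (signPart (y i) : ZMod 3) * v i :=
      Finset.measurable_fun_sum _ fun i _ =>
        ((measurable_from_top (f := fun z : ℤ => (z : ZMod 3) * v i)).comp
          measurable_signPart).comp (measurable_pi_apply i)
    exact this (measurableSet_singleton 0).compl
  have hmul := congrArg ENNReal.toReal (hind.measure_inter_preimage_eq_mul _ _ hmA hmB)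
  rw [ENNReal.toReal_mul] at hmul
  have e1 : (fun (a : ι → ℝ) (i : (Sᶜ : Finset ι)) => a i) ⁻¹' {y | ∀ i, y i = 0}
      = {x | ∀ i, i ∉ S → x i = 0} := by
    ext x; simp
  have e2 : (fun (a : ι → ℝ) (i : T) => a i) ⁻¹'
      {y | ∑ i, (signPart (y i) : ZMod 3) * v i ≠ 0}
      = {x | ∑ i ∈ T, (signPart (x i) : ZMod 3) * v i ≠ 0} := by
    ext x
    simp only [Set.mem_preimage, Set.mem_ofPred_eq]
    rw [Finset.sum_coe_sort T fun i => (signPart (x i) : ZMod 3) * v i]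
  have e3 : ∀ x : ι → ℝ, ∑ i ∈ T, (signPart (x i) : ZMod 3) * v i
      = ∑ i, (signPart (x i) : ZMod 3) * v i := by
    intro x
    refine Finset.sum_subset (Finset.subset_univ _) fun i _ hi => ?_
    simp only [hT, Finset.mem_filter, Finset.mem_univ, true_and, not_not] at hi
    rw [hi, mul_zero]
  rw [e1, e2] at hmul
  simp only [e3] at hmul hB
  refine le_trans ?_ (le_of_eq hmul.symm)
  exact mul_le_mul (by rw [measureReal_def] at hA; linarith) hB (by positivity)
    ENNReal.toReal_nonneg

end Row

/-! ### The whole sample: identification of the head and number of collisions. -/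

section Sample

variable {ι : Type*} [Fintype ι] {q : ι → ℝ}

/-- Some nonzero vector over `ZMod 3` supported on `S` is orthogonal to every row of `X` that
vanishes outside `S`. -/
def HasModThreeKernel {ρ : Type*} (S : Finset ι) (X : ρ → ι → ℝ) : Prop :=
  ∃ v : ι → ZMod 3, (∀ i, i ∉ S → v i = 0) ∧ v ≠ 0 ∧
    ∀ r, (∀ i, i ∉ S → X r i = 0) → ∑ i, (signPart (X r i) : ZMod 3) * v i = 0

theorem eq_zero_of_not_hasModThreeKernel {ρ : Type*} [Fintype ρ] {S : Finset ι} {X : ρ → ι → ℝ}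
    (hX : ∀ r i, X r i = signPart (X r i)) (h : ¬ HasModThreeKernel S X) (z : ι → ℝ)
    (hz : ∀ r, (∀ i, i ∉ S → X r i = 0) → ∑ i, X r i * z i = 0) : ∀ i ∈ S, z i = 0 := by
  classical
  have hsum : ∀ {R : Type} [CommRing R] (r : ρ) (w : ι → R), (∀ i, i ∉ S → X r i = 0) →
      ∑ i, (signPart (X r i) : R) * w i = ∑ i : S, (signPart (X r i) : R) * w i := by
    intro R _ r w hr
    rw [Finset.sum_coe_sort S fun i => (signPart (X r i) : R) * w i]
    refine (Finset.sum_subset (Finset.subset_univ _) fun i _ hi => ?_).symm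
    rw [hr i hi, signPart_zero, Int.cast_zero, zero_mul]
  have key := int_matrix_mulVec_injective_of_mod_three
    (m := {r : ρ // ∀ i, i ∉ S → X r i = 0}) (n := S)
    (Matrix.of fun r i => signPart (X r.1 i)) ?_ (fun i => z i) ?_
  · exact fun i hi => congrFun key ⟨i, hi⟩
  · intro v hv
    by_contra hne
    refine h ⟨fun i => if hi : i ∈ S then v ⟨i, hi⟩ else 0, fun i hi => by simp [hi], ?_, ?_⟩
    · intro h0
      refine hne (funext fun i => ?_)
      simpa using congrFun h0 i.1
    · intro r hr
      rw [hsum r _ hr]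
      simpa [Matrix.mulVec, dotProduct] using congrFun hv ⟨r, hr⟩
  · funext r
    have := hz r.1 r.2
    rw [Finset.sum_congr rfl fun i _ => by rw [hX r.1 i], hsum r.1 _ r.2] at this
    simpa [Matrix.mulVec, dotProduct] using this

theorem ae_eq_signPart (h0 : ∀ i, 0 ≤ q i) (h1 : ∀ i, q i ≤ 1) (n : ℕ) :
    ∀ᵐ X ∂(Measure.pi fun _ : Fin n => Measure.pi fun i => signLaw (q i)),
      ∀ r i, X r i = (signPart (X r i) : ℝ) := by
  have := fun i => isProbabilityMeasure_signLaw (h0 i) (h1 i)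
  rw [ae_all_iff]; intro r
  rw [ae_all_iff]; intro i
  have hi := (measurePreserving_eval (fun i => signLaw (q i)) i).quasiMeasurePreserving.ae
    (ae_signLaw_eq_signPart (q i))
  exact (measurePreserving_eval
    (fun _ : Fin n => Measure.pi fun i => signLaw (q i)) r).quasiMeasurePreserving.ae hi

theorem measureReal_forall_notMem_le {Ω : Type*} [MeasurableSpace Ω] (μ : Measure Ω)
    [IsProbabilityMeasure μ] (n : ℕ) {A : Set Ω} (hA : MeasurableSet A) :
    (Measure.pi fun _ : Fin n => μ).real {X | ∀ r, X r ∉ A} ≤ Real.exp (-(n * μ.real A)) := by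
  have hset : {X : Fin n → Ω | ∀ r, X r ∉ A} = Set.univ.pi fun _ => Aᶜ := by
    ext X; simp
  rw [hset, measureReal_def, Measure.pi_pi, Finset.prod_const, ENNReal.toReal_pow,
    Finset.card_univ, Fintype.card_fin, ← measureReal_def, probReal_compl_eq_one_sub hA]
  calc (1 - μ.real A) ^ n ≤ Real.exp (-μ.real A) ^ n := by
        refine pow_le_pow_left₀ (by linarith [measureReal_le_one (μ := μ) (s := A)]) ?_ n
        linarith [Real.add_one_le_exp (-μ.real A)]
    _ = _ := by rw [← Real.exp_nat_mul]; ring_nf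

/-- Union bound over nonzero v supported on S. A vector with w nonzero entries escapes all rows with
probability at most exp(-nc min(1/3, wπ/2)), which is at most the sum of the two exponentials. The
first is summed over at most 3^|S| vectors; the second is t^w, a product over coordinates, so its
sum factors. -/
theorem measureReal_hasModThreeKernel_le (h0 : ∀ i, 0 ≤ q i) (h1 : ∀ i, q i ≤ 1) (n : ℕ)
    {π c : ℝ} (hπ0 : 0 ≤ π) (S : Finset ι) [DecidablePred (· ∉ S)]
    (hπ : ∀ i ∈ S, π ≤ q i) (htail : ∑ i ∈ Finset.univ.filter (· ∉ S), q i ≤ 1 - c) :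
    (Measure.pi fun _ : Fin n => Measure.pi fun i => signLaw (q i)).real
        {X | HasModThreeKernel S X} ≤
      3 ^ S.card * Real.exp (-(n * c / 3))
        + ((1 + 2 * Real.exp (-(n * c * π / 2))) ^ S.card - 1) := by
  classical
  have := fun i => isProbabilityMeasure_signLaw (h0 i) (h1 i)
  set μ := Measure.pi fun i => signLaw (q i) with hμ
  set t := Real.exp (-(n * c * π / 2)) with ht
  set V : Finset (ι → ZMod 3) := Fintype.piFinset fun i => if i ∈ S then Finset.univ else {0}
    with hV
  have hmemV : ∀ v, v ∈ V ↔ ∀ i, i ∉ S → v i = 0 := by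
    intro v
    rw [hV, Fintype.mem_piFinset]
    refine forall_congr' fun i => ?_
    by_cases hi : i ∈ S <;> simp [hi]
  let A : (ι → ZMod 3) → Set (ι → ℝ) := fun v =>
    {x | (∀ i, i ∉ S → x i = 0) ∧ ∑ i, (signPart (x i) : ZMod 3) * v i ≠ 0}
  have hA : ∀ v, MeasurableSet (A v) := by
    intro v
    have hm1 : MeasurableSet {x : ι → ℝ | ∀ i, i ∉ S → x i = 0} := by
      simp only [Set.ofPred_forall]
      exact MeasurableSet.iInter fun i => MeasurableSet.iInter fun _ =>
        measurableSet_eq_fun (measurable_pi_apply i) measurable_const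
    refine hm1.inter ?_
    let _ : MeasurableSpace (ZMod 3) := ⊤
    have : Measurable fun x : ι → ℝ => ∑ i, (signPart (x i) : ZMod 3) * v i :=
      Finset.measurable_fun_sum _ fun i _ =>
        ((measurable_from_top (f := fun z : ℤ => (z : ZMod 3) * v i)).comp
          measurable_signPart).comp (measurable_pi_apply i)
    exact this (measurableSet_singleton 0).compl
  have hbound : ∀ v ∈ V, (Measure.pi fun _ : Fin n => μ).real {X | ∀ r, X r ∉ A v} ≤
      Real.exp (-(n * c / 3)) + ∏ i, if v i ≠ 0 then t else 1 := by
    intro v hv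
    have hrow := le_measureReal_row h0 h1 hπ0 S v hπ ((hmemV v).1 hv) htail
    refine (measureReal_forall_notMem_le μ n (hA v)).trans ?_
    rw [Finset.prod_ite, Finset.prod_const_one, mul_one, Finset.prod_const, ht,
      ← Real.exp_nat_mul]
    set w : ℝ := ((Finset.univ.filter (fun i => v i ≠ 0)).card : ℝ) with hw
    have hn := mul_le_mul_of_nonneg_left hrow (Nat.cast_nonneg (α := ℝ) n)
    rcases le_total (1 / 3) (w * (π / 2)) with h | h
    · rw [min_eq_left h] at hn
      refine (Real.exp_le_exp.2 ?_).trans (le_add_of_nonneg_right (Real.exp_pos _).le)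
      have : n * (c * (1 / 3)) ≤ n * μ.real (A v) := hn
      linarith
    · rw [min_eq_right h] at hn
      refine (Real.exp_le_exp.2 ?_).trans (le_add_of_nonneg_left (Real.exp_pos _).le)
      have : n * (c * (w * (π / 2))) ≤ n * μ.real (A v) := hn
      linarith
  -- Each coordinate in S takes one zero residue and two nonzero ones. The term v = 0 equals 1 and
  -- is subtracted at the end.
  have hsum : ∑ v ∈ V, ∏ i, (if v i ≠ 0 then t else 1) = (1 + 2 * t) ^ S.card := by
    rw [hV, ← Finset.prod_univ_sum (fun i => if i ∈ S then Finset.univ else {0})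
      fun _ (c : ZMod 3) => if c ≠ 0 then t else 1]
    have : ∀ i, (∑ c ∈ (if i ∈ S then Finset.univ else {0} : Finset (ZMod 3)),
        if c ≠ 0 then t else 1) = if i ∈ S then 1 + 2 * t else 1 := by
      intro i
      by_cases hi : i ∈ S
      · simp only [hi, if_true]
        rw [Finset.sum_ite]
        simp only [Finset.sum_const, nsmul_eq_mul, mul_one]
        rw [show (Finset.univ.filter fun c : ZMod 3 => c ≠ 0).card = 2 by decide,
          show (Finset.univ.filter fun c : ZMod 3 => ¬ c ≠ 0).card = 1 by decide]
        push_cast; ring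
      · simp [hi]
    simp only [this, Finset.prod_ite_mem, Finset.univ_inter, Finset.prod_const]
  have hcard : (V.card : ℝ) = 3 ^ S.card := by
    rw [hV, Fintype.card_piFinset]
    have : ∀ i, (if i ∈ S then Finset.univ else {0} : Finset (ZMod 3)).card
        = if i ∈ S then 3 else 1 := fun i => by
      by_cases hi : i ∈ S
      · simp only [hi, if_true]; rfl
      · simp [hi]
    simp only [this, Finset.prod_ite_mem, Finset.univ_inter, Finset.prod_const]
    push_cast; rfl
  have h0V : (0 : ι → ZMod 3) ∈ V := (hmemV 0).2 fun _ _ => rfl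
  calc (Measure.pi fun _ : Fin n => μ).real {X | HasModThreeKernel S X}
      ≤ (Measure.pi fun _ : Fin n => μ).real (⋃ v ∈ V.erase 0, {X | ∀ r, X r ∉ A v}) := by
        refine measureReal_mono ?_ (measure_ne_top _ _)
        rintro X ⟨v, hv, hv0, hX⟩
        simp only [Set.mem_iUnion]
        exact ⟨v, Finset.mem_erase.2 ⟨hv0, (hmemV v).2 hv⟩, fun r hr => hr.2 (hX r hr.1)⟩
    _ ≤ ∑ v ∈ V.erase 0, (Measure.pi fun _ : Fin n => μ).real {X | ∀ r, X r ∉ A v} :=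
        measureReal_biUnion_finset_le _ _
    _ ≤ ∑ v ∈ V.erase 0, (Real.exp (-(n * c / 3)) + ∏ i, if v i ≠ 0 then t else 1) :=
        Finset.sum_le_sum fun v hv => hbound v (Finset.mem_of_mem_erase hv)
    _ ≤ _ := by
        rw [Finset.sum_add_distrib, Finset.sum_const, nsmul_eq_mul,
          Finset.sum_erase_eq_sub h0V, hsum, ← hcard]
        refine add_le_add (mul_le_mul_of_nonneg_right ?_ (Real.exp_pos _).le) (by simp)
        exact_mod_cast Finset.card_le_card (Finset.erase_subset _ _)

/-- Markov's inequality for the number of triples (row, i, j) with two distinct tail features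
present: it dominates the number of collisions and has mean at most n(Σ qᵢ)². -/
theorem mul_measureReal_le_card_collisions_le (h0 : ∀ i, 0 ≤ q i) (h1 : ∀ i, q i ≤ 1) (n : ℕ)
    (S : Finset ι) [DecidablePred (· ∉ S)] (c : ℝ) :
    c * (Measure.pi fun _ : Fin n => Measure.pi fun i => signLaw (q i)).real
        {X | c ≤ ((collisions S X).card : ℝ)} ≤
      n * (∑ i ∈ Finset.univ.filter (· ∉ S), q i) ^ 2 := by
  classical
  have := fun i => isProbabilityMeasure_signLaw (h0 i) (h1 i)
  set μ := Measure.pi fun i => signLaw (q i) with hμ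
  rcases le_or_gt c 0 with hc | hc
  · exact (mul_nonpos_of_nonpos_of_nonneg hc measureReal_nonneg).trans (by positivity)
  set T := Finset.univ.filter (· ∉ S) with hT
  let E : Fin n → ι → ι → Set (Fin n → ι → ℝ) := fun r i j => {X | X r i ≠ 0 ∧ X r j ≠ 0}
  let B : ι → ι → Set (ι → ℝ) := fun i j => {x | x i ≠ 0 ∧ x j ≠ 0}
  have hB : ∀ i j, MeasurableSet (B i j) := fun i j =>
    (measurable_pi_apply i (measurableSet_singleton 0).compl).inter
      (measurable_pi_apply j (measurableSet_singleton 0).compl)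
  have hE : ∀ r i j, MeasurableSet (E r i j) := fun r i j =>
    (measurable_pi_apply (X := fun _ : Fin n => ι → ℝ) r) (hB i j)
  have hEq : ∀ r i j, i ≠ j → (Measure.pi fun _ : Fin n => μ).real (E r i j) = q i * q j := by
    intro r i j hij
    rw [← measureReal_ne_zero_and_ne_zero h0 h1 hij]
    have := (measurePreserving_eval (fun _ : Fin n => μ) r).measure_preimage
      (hB i j).nullMeasurableSet
    exact congrArg ENNReal.toReal this
  let f : (Fin n → ι → ℝ) → ℝ := fun X =>
    ∑ i ∈ T, ∑ r, ∑ j ∈ T.erase i, (E r i j).indicator 1 X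
  have hle : ∀ X, ((collisions S X).card : ℝ) ≤ f X := by
    intro X
    have h01 : ∀ r i j, 0 ≤ (E r i j).indicator (1 : (Fin n → ι → ℝ) → ℝ) X := fun r i j =>
      Set.indicator_nonneg (fun _ _ => zero_le_one) X
    have hsub : collisions S X ⊆ T := fun i hi => by
      simp only [collisions, Finset.mem_filter, Finset.mem_univ, true_and] at hi
      simpa [hT] using hi.1
    calc ((collisions S X).card : ℝ) = ∑ i ∈ collisions S X, (1 : ℝ) := by simp
      _ ≤ ∑ i ∈ collisions S X, ∑ r, ∑ j ∈ T.erase i, (E r i j).indicator (1 : (Fin n → ι → ℝ) → ℝ) X := by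
          refine Finset.sum_le_sum fun i hi => ?_
          simp only [collisions, Finset.mem_filter, Finset.mem_univ, true_and] at hi
          obtain ⟨_, r, j, hj, hji, hri, hrj⟩ := hi
          have hjT : j ∈ T.erase i := Finset.mem_erase.2 ⟨hji, by simpa [hT] using hj⟩
          calc (1 : ℝ) = (E r i j).indicator (1 : (Fin n → ι → ℝ) → ℝ) X :=
                (Set.indicator_of_mem (f := (1 : (Fin n → ι → ℝ) → ℝ))
                  (show X ∈ E r i j from ⟨hri, hrj⟩)).symm
            _ ≤ ∑ j ∈ T.erase i, (E r i j).indicator (1 : (Fin n → ι → ℝ) → ℝ) X :=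
                Finset.single_le_sum (fun j _ => h01 r i j) hjT
            _ ≤ _ := Finset.single_le_sum
                (f := fun r => ∑ j ∈ T.erase i, (E r i j).indicator (1 : (Fin n → ι → ℝ) → ℝ) X)
                (fun r _ => Finset.sum_nonneg fun j _ => h01 r i j) (Finset.mem_univ r)
      _ ≤ f X := Finset.sum_le_sum_of_subset_of_nonneg hsub fun i _ _ =>
          Finset.sum_nonneg fun r _ => Finset.sum_nonneg fun j _ => h01 r i j
  have hint : ∀ r i j, Integrable ((E r i j).indicator (1 : (Fin n → ι → ℝ) → ℝ))
      (Measure.pi fun _ : Fin n => μ) := fun r i j =>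
    (integrable_const (1 : ℝ)).indicator (hE r i j)
  have hintr : ∀ i r, Integrable (fun X => ∑ j ∈ T.erase i, (E r i j).indicator (1 : (Fin n → ι → ℝ) → ℝ) X)
      (Measure.pi fun _ : Fin n => μ) := fun i r => integrable_finsetSum _ fun j _ => hint r i j
  have hinti : ∀ i, Integrable
      (fun X => ∑ r, ∑ j ∈ T.erase i, (E r i j).indicator (1 : (Fin n → ι → ℝ) → ℝ) X)
      (Measure.pi fun _ : Fin n => μ) := fun i => integrable_finsetSum _ fun r _ => hintr i r
  have hf : ∫ X, f X ∂(Measure.pi fun _ : Fin n => μ) ≤ n * (∑ i ∈ T, q i) ^ 2 := by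
    rw [integral_finsetSum _ fun i _ => hinti i]
    calc ∑ i ∈ T, ∫ X, ∑ r, ∑ j ∈ T.erase i, (E r i j).indicator (1 : (Fin n → ι → ℝ) → ℝ) X
          ∂(Measure.pi fun _ : Fin n => μ)
        = ∑ i ∈ T, ∑ r : Fin n, ∑ j ∈ T.erase i, q i * q j := by
          refine Finset.sum_congr rfl fun i _ => ?_
          rw [integral_finsetSum _ fun r _ => hintr i r]
          refine Finset.sum_congr rfl fun r _ => ?_
          rw [integral_finsetSum _ fun j _ => hint r i j]
          refine Finset.sum_congr rfl fun j hj => ?_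
          rw [integral_indicator_one (hE r i j), hEq r i j (Finset.ne_of_mem_erase hj).symm]
      _ ≤ ∑ i ∈ T, ∑ r : Fin n, ∑ j ∈ T, q i * q j :=
          Finset.sum_le_sum fun i _ => Finset.sum_le_sum fun r _ =>
            Finset.sum_le_sum_of_subset_of_nonneg (Finset.erase_subset _ _) fun j _ _ =>
              mul_nonneg (h0 i) (h0 j)
      _ = _ := by
          simp only [← Finset.mul_sum, Finset.sum_const, Finset.card_univ, Fintype.card_fin,
            nsmul_eq_mul, sq]
          rw [← Finset.sum_mul]; ring
  have hmarkov := mul_meas_ge_le_integral_of_nonneg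
    (Filter.Eventually.of_forall fun X => (Nat.cast_nonneg _).trans (hle X))
    (integrable_finsetSum _ fun i _ => hinti i) c
  refine (mul_le_mul_of_nonneg_left ?_ hc.le).trans (hmarkov.trans hf)
  exact measureReal_mono (fun X hX => le_trans hX (hle X)) (measure_ne_top _ _)

end Sample

/-! ### Loss bound outside the exceptional events. -/

open Classical in
theorem sum_filter_notMem_eq_tailProb (d : ℕ) (p : ℕ → ℝ) (k : ℕ) :
    ∑ j ∈ Finset.univ.filter (· ∉ Finset.univ.filter fun j : Fin d => (j : ℕ) < k), p (j + 1)
      = tailProb d p k := by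
  unfold tailProb
  refine Finset.sum_bij (fun j _ => (j : ℕ) + 1) ?_ ?_ ?_ ?_
  · intro j hj
    simp only [Finset.mem_filter, Finset.mem_univ, true_and] at hj
    rw [Finset.mem_Ioc]
    omega
  · intro i _ j _ h
    exact Fin.ext (by omega)
  · intro i hi
    rw [Finset.mem_Ioc] at hi
    refine ⟨⟨i - 1, by omega⟩, ?_, by simp; omega⟩
    simp only [Finset.mem_filter, Finset.mem_univ, true_and]
    omega
  · intro _ _; rfl

theorem testLoss_eq {d : ℕ} {p : ℕ → ℝ} (hp : IsFeatureProb d p) (β b : Fin d → ℝ) :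
    testLoss p β b = ∑ j : Fin d, p (j + 1) * (b j - β j) ^ 2 := by
  rw [testLoss, featureLaw, ← integral_sq_sum_signLaw (fun j : Fin d => p (j + 1))
    (fun j => b j - β j) (fun j => (hp.pos _ (by omega) (by omega)).le)
    (fun j => hp.le_one _ (by omega) (by omega))]
  refine integral_congr_ae (Filter.Eventually.of_forall fun x => ?_)
  simp only [dotProduct, sub_mul, Finset.sum_sub_distrib]

/-- The loss exceeds `M² p_{>k} + 200 M² n p_k p_{>k}²` only if the head fails to be identified
or the tail features collide unusually often. -/
theorem measureReal_noiselessLoss_gt_le {d n k : ℕ} {p : ℕ → ℝ} {cp M : ℝ} {β : Fin d → ℝ}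
    (hp : IsFeatureProb d p) (hk : 1 ≤ k) (hkd : k < d) (hn : 0 < n)
    (htail : tailProb d p k ≤ 1 - cp) (hβ : ∀ j, |β j| ≤ M) :
    (trainLaw n d p).real {X | noiselessLoss p β X ≤
        M ^ 2 * tailProb d p k + p k * M ^ 2 * (200 * n * tailProb d p k ^ 2)}ᶜ ≤
      3 ^ k * Real.exp (-(n * cp / 3))
        + ((1 + 2 * Real.exp (-(n * cp * p k / 2))) ^ k - 1) + 1 / 200 := by
  classical
  set q : Fin d → ℝ := fun j => p (j + 1) with hq
  have h0 : ∀ j, 0 ≤ q j := fun j => (hp.pos _ (by omega) (by omega)).le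
  have h1 : ∀ j, q j ≤ 1 := fun j => hp.le_one _ (by omega) (by omega)
  have := fun i => isProbabilityMeasure_signLaw (h0 i) (h1 i)
  set S : Finset (Fin d) := Finset.univ.filter fun j => (j : ℕ) < k with hS
  have hmemS : ∀ j, j ∈ S ↔ (j : ℕ) < k := by simp [hS]
  have hScard : S.card ≤ k := by
    have := Finset.card_le_card_of_injOn (s := S) (t := Finset.range k) (fun j => (j : ℕ))
      (fun j hj => by simpa using (hmemS j).1 hj) (fun i _ j _ h => Fin.ext h)
    simpa using this
  have hsum : ∑ j ∈ Finset.univ.filter (· ∉ S), q j = tailProb d p k :=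
    sum_filter_notMem_eq_tailProb d p k
  set P := tailProb d p k with hP
  have hPpos : 0 < P := by
    rw [hP, tailProb]
    refine Finset.sum_pos (fun i hi => ?_) ⟨d, Finset.mem_Ioc.2 ⟨hkd, le_rfl⟩⟩
    rw [Finset.mem_Ioc] at hi
    exact hp.pos i (by omega) hi.2
  -- The factor 200 makes Markov's inequality fail with probability at most 1/200, half of the
  -- allowed 1/100.
  set N : ℝ := 200 * n * P ^ 2 with hN
  have hn' : (0 : ℝ) < n := by exact_mod_cast hn
  have hNpos : 0 < N := by positivity
  have hpk : 0 < p k := hp.pos k hk hkd.le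
  set ν := Measure.pi fun _ : Fin n => Measure.pi fun i => signLaw (q i) with hν
  have hνt : trainLaw n d p = ν := rfl
  have hker := measureReal_hasModThreeKernel_le h0 h1 n hpk.le S
    (fun j hj => hp.anti (j + 1) k (by omega) (by have := (hmemS j).1 hj; omega) hkd.le)
    (hsum.trans_le htail)
  have hcol := mul_measureReal_le_card_collisions_le h0 h1 n S N
  rw [hsum] at hcol
  have hcol' : ν.real {X | N ≤ ((collisions S X).card : ℝ)} ≤ 1 / 200 := by
    have : N * ν.real {X | N ≤ ((collisions S X).card : ℝ)} ≤ N * (1 / 200) :=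
      hcol.trans (le_of_eq (by rw [hN]; ring))
    exact le_of_mul_le_mul_left this hNpos
  have hnull : ν.real {X | ¬ ∀ r i, X r i = (signPart (X r i) : ℝ)} = 0 := by
    rw [measureReal_def, ae_iff.1 (ae_eq_signPart h0 h1 n), ENNReal.toReal_zero]
  have hsub : {X | noiselessLoss p β X ≤ M ^ 2 * P + p k * M ^ 2 * N}ᶜ ⊆
      {X : Fin n → Fin d → ℝ | ¬ ∀ r i, X r i = (signPart (X r i) : ℝ)} ∪
        ({X | HasModThreeKernel S X} ∪ {X | N ≤ ((collisions S X).card : ℝ)}) := by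
    intro X hX
    by_contra hcon
    simp only [Set.mem_union, Set.mem_ofPred_eq, not_or, not_not, not_le] at hcon
    obtain ⟨hXint, hXker, hXcol⟩ := hcon
    refine hX ?_
    have hy : (fun i => β ⬝ᵥ X i) = Matrix.of X *ᵥ β := by
      funext i
      simp [Matrix.mulVec, dotProduct_comm]
    change noiselessLoss p β X ≤ _
    rw [noiselessLoss, hy, testLoss_eq hp]
    refine (sum_mul_sq_error_le S (Matrix.of X) q β _ M (p k) h0 ?_ hβ
      (mulVec_minNormEstimator _ _) (minNormEstimator_dotProduct_of_mulVec_eq_zero _ _)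
      (eq_zero_of_not_hasModThreeKernel hXint hXker)).trans ?_
    · intro j hj
      exact hp.anti k (j + 1) hk (by have := (hmemS j).not.1 hj; omega) (by omega)
    · rw [hsum]
      have : (((collisions S (Matrix.of X)).card : ℕ) : ℝ) ≤ N := hXcol.le
      gcongr
  rw [hνt]
  have hpow : ∀ x : ℝ, 1 ≤ x → x ^ S.card ≤ x ^ k := fun x hx => pow_le_pow_right₀ hx hScard
  calc ν.real {X | noiselessLoss p β X ≤ M ^ 2 * P + p k * M ^ 2 * N}ᶜ
      ≤ ν.real {X | ¬ ∀ r i, X r i = (signPart (X r i) : ℝ)} + (ν.real {X | HasModThreeKernel S X}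
          + ν.real {X | N ≤ ((collisions S X).card : ℝ)}) :=
        (measureReal_mono hsub (measure_ne_top _ _)).trans
          ((measureReal_union_le _ _).trans (by gcongr; exact measureReal_union_le _ _))
    _ ≤ _ := by
        rw [hnull, zero_add]
        refine add_le_add (hker.trans (add_le_add ?_ (sub_le_sub_right ?_ 1))) hcol'
        · exact mul_le_mul_of_nonneg_right (hpow 3 (by norm_num)) (Real.exp_pos _).le
        · exact hpow _ (by have := Real.exp_pos (-(n * cp * p k / 2)); linarith)

/-! ### Numerical constants and the bound with probability 0.99. -/

theorem exp_neg_le_inv {y : ℝ} (hy : 0 < y) : Real.exp (-y) ≤ 1 / y := by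
  rw [Real.exp_neg, ← one_div]
  exact one_div_le_one_div_of_le hy (by linarith [Real.add_one_le_exp y])

/-- Each summand is at most 1/800. For the first, n exceeds kL and L·cp ≥ 4800, which beats 3^k ≤
exp(2k). For the second, k ≤ d = exp L is beaten by exp(-cp·a·L²/2) ≤ exp(-2L), since L·cp·a ≥ 4;
this is where nπ must be of order L². -/
theorem failure_probability_le {n k L cp a π d : ℝ} {m : ℕ} (hm : (m : ℝ) = k) (ha : 0 < a)
    (hcp : 0 < cp) (hL : 3200 ≤ L) (hLc : 4800 / cp ≤ L) (hLa : 4 / (cp * a) ≤ L)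
    (hd : d = Real.exp L) (hk : L ^ 4 < k) (hkn : k * L ^ 4 < n) (hkd : k ≤ d)
    (hπ : a * L ^ 2 ≤ n * π) :
    3 ^ m * Real.exp (-(n * cp / 3)) + ((1 + 2 * Real.exp (-(n * cp * π / 2))) ^ m - 1)
      ≤ 1 / 400 := by
  have hL4 : L ≤ L ^ 4 := le_self_pow₀ (by linarith) (by norm_num)
  rw [div_le_iff₀ hcp] at hLc
  rw [div_le_iff₀ (by positivity)] at hLa
  have hk0 : 0 < k := by linarith
  have e1 : (3 : ℝ) ^ m * Real.exp (-(n * cp / 3)) ≤ 1 / 800 := by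
    have h3 : (3 : ℝ) ≤ Real.exp 2 := by linarith [Real.add_one_le_exp 2]
    calc (3 : ℝ) ^ m * Real.exp (-(n * cp / 3))
        ≤ Real.exp 2 ^ m * Real.exp (-(n * cp / 3)) := by gcongr
      _ = Real.exp (2 * k - n * cp / 3) := by
          rw [← Real.exp_nat_mul, hm, ← Real.exp_add]; ring_nf
      _ ≤ Real.exp (-(800)) := by
          refine Real.exp_le_exp.2 ?_
          have h1 : k * L * cp ≤ n * cp := by
            refine mul_le_mul_of_nonneg_right (le_trans ?_ hkn.le) hcp.le
            exact mul_le_mul_of_nonneg_left hL4 hk0.le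
          have h2 : k * 4800 ≤ k * (L * cp) := mul_le_mul_of_nonneg_left hLc hk0.le
          nlinarith
      _ ≤ 1 / 800 := exp_neg_le_inv (by norm_num)
  have e2 : 2 * k * Real.exp (-(n * cp * π / 2)) ≤ 2 / 3200 := by
    calc 2 * k * Real.exp (-(n * cp * π / 2))
        ≤ 2 * Real.exp L * Real.exp (-(cp * (a * L ^ 2) / 2)) := by
          rw [← hd]
          have : -(n * cp * π / 2) ≤ -(cp * (a * L ^ 2) / 2) := by
            have := mul_le_mul_of_nonneg_left hπ hcp.le
            linarith
          have hd0 : 0 ≤ d := hk0.le.trans hkd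
          gcongr
      _ = 2 * Real.exp (L - cp * (a * L ^ 2) / 2) := by
          rw [mul_assoc, ← Real.exp_add]; ring_nf
      _ ≤ 2 * Real.exp (-3200) := by
          gcongr
          nlinarith
      _ ≤ 2 * (1 / 3200) := by
          gcongr
          exact exp_neg_le_inv (by norm_num)
      _ = 2 / 3200 := by norm_num
  have e3 : (1 + 2 * Real.exp (-(n * cp * π / 2))) ^ m ≤ 1 + 1 / 800 := by
    set t := Real.exp (-(n * cp * π / 2))
    calc (1 + 2 * t) ^ m ≤ Real.exp (2 * t) ^ m := by
          have := (Real.exp_pos (-(n * cp * π / 2))).le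
          refine pow_le_pow_left₀ (by positivity) ?_ m
          linarith [Real.add_one_le_exp (2 * t)]
      _ = Real.exp (2 * k * t) := by rw [← Real.exp_nat_mul, hm]; ring_nf
      _ ≤ Real.exp (2 / 3200) := Real.exp_le_exp.2 e2
      _ ≤ 1 / (1 - 2 / 3200) := by
          rw [le_div_iff₀ (by norm_num), ← le_div_iff₀' (Real.exp_pos _), one_div, ← Real.exp_neg]
          linarith [Real.add_one_le_exp (-(2 / 3200))]
      _ ≤ 1 + 1 / 800 := by norm_num
  linarith

/-- With probability at least `0.99` the loss is `O(p_{>k} + ln²d · p_{>k}²)`. -/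
theorem le_measureReal_noiselessLoss_le {a b cp M : ℝ} (ha : 0 < a) (hcp : 0 < cp)
    {d n k : ℕ} {p : ℕ → ℝ} {β : Fin d → ℝ}
    (hL : 3200 + 4800 / cp + 4 / (cp * a) ≤ Real.log d) (hreg : ParamRegime 4 n d k)
    (hp : IsFeatureProb d p) (hth : IsThreshold a b cp n d p k) (hβ : ∀ j, |β j| ≤ M) :
    (99 / 100 : ℝ) ≤ (trainLaw n d p).real {X | noiselessLoss p β X ≤
      M ^ 2 * (tailProb d p k + 200 * b * Real.log d ^ 2 * tailProb d p k ^ 2)} := by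
  set L := Real.log d with hLdef
  have h1 : 0 < 4800 / cp := by positivity
  have h2 : 0 < 4 / (cp * a) := by positivity
  have hL1 : 1 ≤ L ^ 4 := one_le_pow₀ (by linarith)
  have hk0 : (0 : ℝ) < k := lt_trans (by linarith) hreg.polylog_lt_k
  have hkn : (k : ℝ) < n := lt_of_le_of_lt (le_mul_of_one_le_right hk0.le hL1) hreg.k_lt_n
  have hn0 : (0 : ℝ) < n := hk0.trans hkn
  have hnd : (n : ℝ) < d := lt_of_le_of_lt (le_mul_of_one_le_right hn0.le hL1) hreg.n_lt_d
  have hkd : k < d := by exact_mod_cast hkn.trans hnd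
  have hk1 : 1 ≤ k := by exact_mod_cast hk0
  have hbad := measureReal_noiselessLoss_gt_le hp hk1 hkd (by exact_mod_cast hn0) hth.tail_le hβ
  have hfail := failure_probability_le (d := d) (m := k) rfl ha hcp (by linarith) (by linarith)
    (by linarith) (Real.exp_log (hn0.trans hnd)).symm hreg.polylog_lt_k hreg.k_lt_n
    (hkn.trans hnd).le hth.lower
  have hprob : IsProbabilityMeasure (trainLaw n d p) := by
    have := fun j : Fin d => isProbabilityMeasure_signLaw
      (hp.pos (j + 1) (by omega) (by omega)).le (hp.le_one (j + 1) (by omega) (by omega))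
    unfold trainLaw featureLaw
    infer_instance
  set G := {X | noiselessLoss p β X ≤
        M ^ 2 * tailProb d p k + p k * M ^ 2 * (200 * n * tailProb d p k ^ 2)} with hG
  have hone : 1 ≤ (trainLaw n d p).real G + (trainLaw n d p).real Gᶜ := by
    have := measureReal_union_le (μ := trainLaw n d p) G Gᶜ
    rwa [Set.union_compl_self, probReal_univ] at this
  have hsub : G ⊆ {X | noiselessLoss p β X ≤
      M ^ 2 * (tailProb d p k + 200 * b * L ^ 2 * tailProb d p k ^ 2)} := by
    intro X hX
    refine le_trans (show noiselessLoss p β X ≤ _ from hX) ?_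
    have h := mul_le_mul_of_nonneg_left hth.upper
      (show 0 ≤ 200 * M ^ 2 * tailProb d p k ^ 2 by positivity)
    linarith
  have := measureReal_mono (μ := trainLaw n d p) hsub (measure_ne_top _ _)
  linarith

/-! ### Power-law tails. -/

theorem isFeatureProb_powerLaw {d : ℕ} {s α : ℝ} (hd : 1 ≤ d) (hs : 0 < s) (hα : 0 < α) :
    1 ≤ ∑ l ∈ Finset.Icc 1 d, (l : ℝ) ^ (-α) ∧ IsFeatureProb d (powerLaw d s α) := by
  have hZ : 1 ≤ ∑ l ∈ Finset.Icc 1 d, (l : ℝ) ^ (-α) := by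
    have := Finset.single_le_sum (f := fun l : ℕ => (l : ℝ) ^ (-α)) (s := Finset.Icc 1 d)
      (fun l _ => by positivity) (Finset.mem_Icc.2 ⟨le_rfl, hd⟩)
    simpa using this
  have hZ0 := zero_lt_one.trans_le hZ
  refine ⟨hZ, fun i j hi hij _ => ?_, fun i hi _ => ?_, fun i _ _ => min_le_left _ _⟩
  · refine min_le_min_left _ ?_
    gcongr ?_ / _
    refine mul_le_mul_of_nonneg_left ?_ hs.le
    exact Real.rpow_le_rpow_of_nonpos (by exact_mod_cast hi) (by exact_mod_cast hij)
      (by linarith)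
  · have : (0 : ℝ) < i := by exact_mod_cast hi
    exact lt_min zero_lt_one (by positivity)

theorem sum_Ioc_rpow_neg_le {k d : ℕ} {α : ℝ} (hk : 1 ≤ k) (hkd : k ≤ d) (hα : 1 < α) :
    ∑ i ∈ Finset.Ioc k d, (i : ℝ) ^ (-α) ≤ k * (k : ℝ) ^ (-α) / (α - 1) := by
  have hk0 : (0 : ℝ) < k := by exact_mod_cast hk
  have hkd' : (k : ℝ) ≤ d := by exact_mod_cast hkd
  have hanti : AntitoneOn (fun x : ℝ => x ^ (-α)) (Set.Icc (k : ℝ) d) := fun x hx y _ hxy =>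
    Real.rpow_le_rpow_of_nonpos (hk0.trans_le hx.1) hxy (by linarith)
  have h := hanti.sum_le_integral_Ico hkd
  have hshift : ∑ i ∈ Finset.Ioc k d, (i : ℝ) ^ (-α)
      = ∑ i ∈ Finset.Ico k d, ((i + 1 : ℕ) : ℝ) ^ (-α) := by
    rw [Finset.sum_Ico_add' (fun i : ℕ => (i : ℝ) ^ (-α))]
    refine Finset.sum_congr (Finset.ext fun i => ?_) fun _ _ => rfl
    rw [Finset.mem_Ioc, Finset.mem_Ico]
    omega
  rw [hshift]
  refine h.trans ?_
  rw [integral_rpow (Or.inr ⟨by linarith, by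
    rw [Set.uIcc_of_le hkd']; exact fun h0 => absurd h0.1 (not_le.2 hk0)⟩)]
  have h1 : (k : ℝ) * (k : ℝ) ^ (-α) = (k : ℝ) ^ (-α + 1) := by
    rw [Real.rpow_add_one hk0.ne']; ring
  rw [h1, ← neg_div_neg_eq, neg_sub, show -(-α + 1) = α - 1 by ring]
  have : (0 : ℝ) ≤ (d : ℝ) ^ (-α + 1) := by positivity
  gcongr
  linarith

/-- Comparison of the sum with an integral. When p_k < 1 the minimum is not saturated at k, so p_k
is the pure power against which the tail is measured. -/
theorem tailProb_powerLaw_le {d k : ℕ} {s α : ℝ} (hk : 1 ≤ k) (hkd : k ≤ d) (hs : 0 < s)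
    (hα : 1 < α) (hlt : powerLaw d s α k < 1) :
    tailProb d (powerLaw d s α) k ≤ k * powerLaw d s α k / (α - 1) := by
  obtain ⟨hZ, -⟩ := isFeatureProb_powerLaw (d := d) (hk.trans hkd) hs (zero_lt_one.trans hα)
  set Z := ∑ l ∈ Finset.Icc 1 d, (l : ℝ) ^ (-α) with hZdef
  have hpk : powerLaw d s α k = s * (k : ℝ) ^ (-α) / Z := by
    rcases min_choice 1 (s * (k : ℝ) ^ (-α) / Z) with h | h
    · exact absurd h hlt.ne
    · exact h
  calc tailProb d (powerLaw d s α) k ≤ ∑ i ∈ Finset.Ioc k d, s * (i : ℝ) ^ (-α) / Z :=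
        Finset.sum_le_sum fun i _ => min_le_right _ _
    _ = s / Z * ∑ i ∈ Finset.Ioc k d, (i : ℝ) ^ (-α) := by
        rw [Finset.mul_sum]; exact Finset.sum_congr rfl fun i _ => by ring
    _ ≤ s / Z * (k * (k : ℝ) ^ (-α) / (α - 1)) := by
        gcongr
        exact sum_Ioc_rpow_neg_le hk hkd hα
    _ = _ := by rw [hpk]; ring

/-- Put u = L²/(ns). The lower threshold and Z ≥ 1 give k^(-α) ≥ au, so k ≤ (au)^(-1/α); the upper
one gives p_k ≤ bsu. The product is of order s·u^(1 - 1/α). -/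
theorem mul_powerLaw_le_powerLawRate {d n k : ℕ} {s α a b : ℝ} (hk : 1 ≤ k) (hkd : k ≤ d)
    (hn : 0 < n) (hs : 0 < s) (hα : 1 < α) (ha : 0 < a) (hL : 0 < Real.log d)
    (hlow : a * Real.log d ^ 2 ≤ n * powerLaw d s α k)
    (hup : n * powerLaw d s α k ≤ b * Real.log d ^ 2) :
    k * powerLaw d s α k ≤ b * a ^ (-(1 / α)) * powerLawRate n d s α := by
  obtain ⟨hZ, -⟩ := isFeatureProb_powerLaw (d := d) (hk.trans hkd) hs (zero_lt_one.trans hα)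
  have hk0 : (0 : ℝ) < k := by exact_mod_cast hk
  have hn0 : (0 : ℝ) < n := by exact_mod_cast hn
  have hα0 : 0 < α := by linarith
  unfold powerLawRate
  set L := Real.log d
  set u := L ^ 2 / (n * s) with hu
  have hu0 : 0 < u := by positivity
  have hLu : L ^ 2 = n * (s * u) := by rw [hu]; field_simp
  have hpk : powerLaw d s α k ≤ s * (k : ℝ) ^ (-α) :=
    (min_le_right _ _).trans (div_le_self (by positivity) hZ)
  have hp1 : powerLaw d s α k ≤ b * (s * u) := by
    rw [hLu] at hup
    refine le_of_mul_le_mul_left (hup.trans_eq ?_) hn0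
    ring
  have hau : a * u ≤ (k : ℝ) ^ (-α) := by
    have h1 : n * s * (a * u) ≤ n * s * (k : ℝ) ^ (-α) := by
      calc n * s * (a * u) = a * L ^ 2 := by rw [hLu]; ring
        _ ≤ n * powerLaw d s α k := hlow
        _ ≤ n * (s * (k : ℝ) ^ (-α)) := by gcongr
        _ = _ := by ring
    exact le_of_mul_le_mul_left h1 (by positivity)
  have hkle : (k : ℝ) ≤ a ^ (-(1 / α)) * u ^ (-(1 / α)) := by
    rw [← Real.mul_rpow ha.le hu0.le]
    have h := Real.rpow_le_rpow_of_nonpos (by positivity) hau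
      (show -(1 / α) ≤ 0 by rw [neg_nonpos]; positivity)
    rwa [← Real.rpow_mul hk0.le, show -α * -(1 / α) = 1 by field_simp, Real.rpow_one] at h
  have hp0 : 0 ≤ b * (s * u) := by
    refine le_trans ?_ hp1
    exact le_min zero_le_one (by positivity)
  calc k * powerLaw d s α k ≤ k * (b * (s * u)) := by gcongr
    _ ≤ a ^ (-(1 / α)) * u ^ (-(1 / α)) * (b * (s * u)) := by gcongr
    _ = b * a ^ (-(1 / α)) * (s * (u ^ (1 : ℝ) * u ^ (-(1 / α)))) := by rw [Real.rpow_one]; ring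
    _ = _ := by rw [← Real.rpow_add hu0, ← sub_eq_add_neg]

/-! ### Comparison with the stated rates and conclusion. -/

theorem tailProb_nonneg {d : ℕ} {p : ℕ → ℝ} (hp : IsFeatureProb d p) (k : ℕ) :
    0 ≤ tailProb d p k :=
  Finset.sum_nonneg fun i hi => (hp.pos i
    (by rw [Finset.mem_Ioc] at hi; omega) (Finset.mem_Ioc.1 hi).2).le

/-- AM-GM in the form P(1 - PL²)² ≥ 0 bounds L²P² by P + P³L⁴; the middle terms of the rate only
need to be nonnegative. -/
theorem tailProb_add_le_generalRate {d n k : ℕ} {p : ℕ → ℝ} {B : ℝ} (hB : 0 ≤ B)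
    (hP : 0 ≤ tailProb d p k) :
    tailProb d p k + B * Real.log d ^ 2 * tailProb d p k ^ 2 ≤ (1 + B) * generalRate n d p k := by
  unfold generalRate
  set P := tailProb d p k
  set L := Real.log d
  have h1 : 0 ≤ k * L ^ 4 / ((n : ℝ) ^ 2 * P) := by positivity
  have h2 : 0 ≤ L ^ 4 / (n : ℝ) := by positivity
  have h3 : 0 ≤ k * P ^ 2 * L ^ 4 / (n : ℝ) := by positivity
  have h4 : 0 ≤ P ^ 3 * L ^ 4 := by positivity
  have h5 : L ^ 2 * P ^ 2 ≤ P + P ^ 3 * L ^ 4 := by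
    nlinarith [mul_nonneg hP (sq_nonneg (1 - P * L ^ 2))]
  have h6 := mul_le_mul_of_nonneg_left h5 hB
  nlinarith [mul_nonneg hB h1, mul_nonneg hB h2, mul_nonneg hB h3]

theorem le_log_of_ceil_exp_le {Λ : ℝ} {d : ℕ} (hd : ⌈Real.exp Λ⌉₊ ≤ d) : Λ ≤ Real.log d := by
  have h : Real.exp Λ ≤ d := Nat.ceil_le.1 hd
  exact (Real.le_log_iff_exp_le ((Real.exp_pos _).trans_le h)).2 h

theorem theorem1 :
    ∃ A : ℕ, ∀ a b cp M : ℝ, 0 < a → a ≤ b → 0 < cp → 0 < M →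
      (∃ C : ℝ, 0 < C ∧ ∃ d₀ : ℕ, ∀ (d n k : ℕ) (p : ℕ → ℝ) (βstar : Fin d → ℝ),
        d₀ ≤ d → ParamRegime A n d k → IsFeatureProb d p → IsThreshold a b cp n d p k →
        (∀ j, |βstar j| ≤ M) →
        (99 / 100 : ℝ) ≤ (trainLaw n d p).real
          {X | noiselessLoss p βstar X ≤ C * generalRate n d p k}) ∧
      (∀ α : ℝ, 1 < α →
        ∃ C : ℝ, 0 < C ∧ ∃ d₀ : ℕ, ∀ (d n k : ℕ) (s : ℝ) (βstar : Fin d → ℝ),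
        d₀ ≤ d → ParamRegime A n d k → 0 < s → IsThreshold a b cp n d (powerLaw d s α) k →
        (∀ j, |βstar j| ≤ M) →
        (99 / 100 : ℝ) ≤ (trainLaw n d (powerLaw d s α)).real
          {X | noiselessLoss (powerLaw d s α) βstar X ≤ C * generalRate n d (powerLaw d s α) k ∧
               noiselessLoss (powerLaw d s α) βstar X ≤ C * powerLawRate n d s α}) := by
  refine ⟨4, fun a b cp M ha hab hcp hM => ⟨?_, fun α hα => ?_⟩⟩
  · have hb : 0 < b := ha.trans_le hab
    refine ⟨M ^ 2 * (1 + 200 * b), by positivity,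
      ⌈Real.exp (3200 + 4800 / cp + 4 / (cp * a))⌉₊, fun d n k p β hd hreg hp hth hβ => ?_⟩
    have hL := le_log_of_ceil_exp_le hd
    have hprob : IsFiniteMeasure (trainLaw n d p) := by
      have := fun j : Fin d => isProbabilityMeasure_signLaw
        (hp.pos (j + 1) (by omega) (by omega)).le (hp.le_one (j + 1) (by omega) (by omega))
      unfold trainLaw featureLaw
      infer_instance
    refine (le_measureReal_noiselessLoss_le ha hcp hL hreg hp hth hβ).trans
      (measureReal_mono (fun X hX => le_trans (show noiselessLoss p β X ≤ _ from hX) ?_)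
        (measure_ne_top _ _))
    rw [mul_assoc (M ^ 2)]
    exact mul_le_mul_of_nonneg_left (tailProb_add_le_generalRate (by positivity)
      (tailProb_nonneg hp k)) (sq_nonneg M)
  · have hb : 0 < b := ha.trans_le hab
    have hα1 : 0 < α - 1 := by linarith
    set K := (1 + 200 * b * (b / (α - 1))) * (b * a ^ (-(1 / α)) / (α - 1)) with hK
    have hK0 : 0 < K := by positivity
    refine ⟨M ^ 2 * (1 + 200 * b) + M ^ 2 * K, by positivity,
      ⌈Real.exp (3200 + 4800 / cp + 4 / (cp * a) + b)⌉₊, fun d n k s β hd hreg hs hth hβ => ?_⟩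
    have hL := le_log_of_ceil_exp_le hd
    set L := Real.log d with hLdef
    have hc1 : 0 < 4800 / cp := by positivity
    have hc2 : 0 < 4 / (cp * a) := by positivity
    have hL0 : 1 ≤ L := by linarith
    have hL1 : 1 ≤ L ^ 4 := one_le_pow₀ hL0
    have hk0 : (0 : ℝ) < k := lt_trans (by linarith) hreg.polylog_lt_k
    have hkn : (k : ℝ) < n := lt_of_le_of_lt (le_mul_of_one_le_right hk0.le hL1) hreg.k_lt_n
    have hn0 : (0 : ℝ) < n := hk0.trans hkn
    have hnd : (n : ℝ) < d := lt_of_le_of_lt (le_mul_of_one_le_right hn0.le hL1) hreg.n_lt_d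
    have hkd : k ≤ d := by exact_mod_cast (hkn.trans hnd).le
    have hk1 : 1 ≤ k := by exact_mod_cast hk0
    have hn1 : 0 < n := by exact_mod_cast hn0
    obtain ⟨-, hp⟩ := isFeatureProb_powerLaw (d := d) (hk1.trans hkd) hs (zero_lt_one.trans hα)
    have hprob : IsFiniteMeasure (trainLaw n d (powerLaw d s α)) := by
      have := fun j : Fin d => isProbabilityMeasure_signLaw
        (hp.pos (j + 1) (by omega) (by omega)).le (hp.le_one (j + 1) (by omega) (by omega))
      unfold trainLaw featureLaw
      infer_instance
    -- The extra summand b in the threshold for d gives b ≤ L, hence np_k ≤ bL² ≤ L⁴ < k < n.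
    have hlt : powerLaw d s α k < 1 := by
      have h1 : b * L ^ 2 < n := by
        have : b * L ^ 2 ≤ L ^ 4 := by nlinarith [sq_nonneg L, pow_le_pow_right₀ hL0 (show 3 ≤ 4 by norm_num)]
        linarith [hreg.polylog_lt_k]
      by_contra h
      have := hth.upper
      nlinarith
    have hPk := tailProb_powerLaw_le hk1 hkd hs hα hlt
    have hrate := mul_powerLaw_le_powerLawRate hk1 hkd hn1 hs hα ha (by linarith) hth.lower
      hth.upper
    have hP0 := tailProb_nonneg hp k
    have hG := tailProb_add_le_generalRate (n := n) (show 0 ≤ 200 * b by positivity) hP0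
    refine (le_measureReal_noiselessLoss_le ha hcp (by linarith) hreg hp hth hβ).trans
      (measureReal_mono (fun X hX => ?_) (measure_ne_top _ _))
    replace hX : noiselessLoss (powerLaw d s α) β X ≤ _ := hX
    set P := tailProb d (powerLaw d s α) k
    -- Here the exponent 4 is used in full: kp_kL² ≤ bkL⁴/n ≤ b. This bounds L²P and makes the
    -- quadratic term comparable to P.
    have hkp : k * powerLaw d s α k * L ^ 2 ≤ b := by
      have h1 := mul_le_mul_of_nonneg_left hth.upper hk0.le
      have h2 : b * (k * L ^ 4) ≤ b * n := mul_le_mul_of_nonneg_left hreg.k_lt_n.le hb.le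
      refine le_of_mul_le_mul_left ?_ hn0
      calc n * (k * powerLaw d s α k * L ^ 2) = k * (n * powerLaw d s α k) * L ^ 2 := by ring
        _ ≤ k * (b * L ^ 2) * L ^ 2 := mul_le_mul_of_nonneg_right h1 (sq_nonneg L)
        _ = b * (k * L ^ 4) := by ring
        _ ≤ n * b := h2.trans_eq (mul_comm _ _)
    have hPL : L ^ 2 * P ≤ b / (α - 1) := by
      rw [le_div_iff₀ hα1] at hPk ⊢
      nlinarith [mul_le_mul_of_nonneg_right hPk (sq_nonneg L)]
    have hPR : P ≤ b * a ^ (-(1 / α)) / (α - 1) * powerLawRate n d s α := by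
      refine hPk.trans ((div_le_div_of_nonneg_right hrate hα1.le).trans_eq ?_)
      ring
    have hsq : P + 200 * b * L ^ 2 * P ^ 2 ≤ K * powerLawRate n d s α := by
      calc P + 200 * b * L ^ 2 * P ^ 2 = (1 + 200 * b * (L ^ 2 * P)) * P := by ring
        _ ≤ (1 + 200 * b * (b / (α - 1)))
            * (b * a ^ (-(1 / α)) / (α - 1) * powerLawRate n d s α) := by gcongr
        _ = _ := by rw [hK]; ring
    have hM2 := sq_nonneg M
    have hG0 : 0 ≤ generalRate n d (powerLaw d s α) k := by
      unfold generalRate; positivity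
    have hR0 : 0 ≤ powerLawRate n d s α := by unfold powerLawRate; positivity
    refine ⟨hX.trans ((mul_le_mul_of_nonneg_left hG hM2).trans ?_),
      hX.trans ((mul_le_mul_of_nonneg_left hsq hM2).trans ?_)⟩
    · nlinarith [mul_nonneg (mul_nonneg hM2 hK0.le) hG0]
    · nlinarith [mul_nonneg (mul_nonneg hM2 (show 0 ≤ 1 + 200 * b by positivity)) hR0]
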